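/- **Circuits.** An *extended arithmetic circuit* with $n$ inputs, $\ell$ auxiliary memory gates and $m$ outputs is a finite simple directed acyclic graph of gates consisting of $n$ ordered input gates and $\ell$ ordered auxiliary memory gates (indegree $0$), $m$ ordered output gates (indegree $1$, outdegree $0$), gates labelled with real constants (indegree $0$), addition and multiplication gates of unbounded fan-in, and function gates (indegree and outdegree $1$), each computing a function $\mathbb{R}\to\mathbb{R}$. Given values for the input and auxiliary memory gates, every gate gets a value in the obvious way. The size is the number of gates and the depth is the length of a longest directed path. An *arithmetic circuit* is one with $\ell=0$. For $i\in\mathbb{N}$ and a set $\mathcal{B}$ of functions $\mathbb{R}\to\mathbb{R}$, a family $(C_n)_{n\in\mathbb{N}}$ of circuits, $C_n$ having $n$ inputs, is an $\mathfrak{F}$-family for $\mathfrak{F}=\mathrm{FAC}^i_{\mathbb{R}}[\mathcal{B}]$ if it has size $n^{O(1)}$, depth $O((\log n)^i)$ and all its function gates compute functions in $\mathcal{B}$. Put $\mathfrak{F}[\mathcal{A}]=\mathrm{FAC}^i_{\mathbb{R}}[\mathcal{B}\cup\mathcal{A}]$ and $\mathfrak{F}_s=\mathfrak{F}[\{\mathrm{sign}\}]$,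 where $\mathrm{sign}(x)=1$ if $x>0$ and $0$ otherwise. **Recurrent circuits.** A *recurrent arithmetic circuit* consists of an underlying extended arithmetic circuit $C$, initial values for its auxiliary memory gates, for every input and auxiliary memory gate exactly one recurrent edge into it from a gate of $C$ that is not an output gate, an ordered set of $p$ distinct halting gates of $C$, and a halting function $f_{\mathrm{halt}}\colon\mathbb{N}_{>0}\times\mathbb{R}^p\to\{0,1\}$. In iteration $k=1,2,\dots$ the circuit $C$ is evaluated on the current values of the input and auxiliary memory gates; if $f_{\mathrm{halt}}$, applied to $k$ and the values of the halting gates, is $1$, the values of the output gates are the result, and otherwise every input and auxiliary memory gate takes the value of the source of its recurrent edge. So the circuit computes a partial function, undefined where it never halts. A partial function $\mathbb{R}^*\to\mathbb{R}^*$ is in $\mathrm{rec}[\mathfrak{F}_{\mathrm{halt}}]\text{-}\mathfrak{F}$ if it is computed by a family of recurrent circuits, one for every input length, whose underlying circuits form an $\mathfrak{F}$-family and for which there is an $\mathfrak{F}_{\mathrm{halt}}$-family $(D_k)_{k\in\mathbb{N}}$ of arithmetic circuits with one output such that the halting function of every circuit of the family with $p$ halting gates is computed by $D_{p+1}$ (on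 the iteration number and the $p$ values). **Networks.** A *labelled graph* $\mathfrak{G}=(V,E,g_V)$ is a finite simple undirected graph with ordered vertex set $V$ and $g_V\colon V\to\mathbb{R}$; its encoding $\langle\mathfrak{G}\rangle\in\mathbb{R}^{|V|^2+|V|}$ is its adjacency matrix, row by row, followed by the values of $g_V$ in the order of $V$. A $\mathrm{rec}[t\mathfrak{F}_s]\text{-}(\mathrm{rec}[t\mathfrak{F}_s]\text{-}t\mathfrak{F},\mathcal{A})$-*GNN* $\textit{rec-}\mathcal{N}$ (a circuit GNN with inner and outer recurrence) consists of (a) a periodic sequence $\mathcal{N}(i)=(f^{(i)},\sigma^{(i)})$, $i\in\mathbb{N}$, where $\sigma^{(i)}\in\mathcal{A}$ and $f^{(i)}$ is a real-valued partial function on $\mathbb{R}^*$ in $\mathrm{rec}[\mathfrak{F}_s]\text{-}\mathfrak{F}$ that is tail-symmetric, i.e. invariant under permutations of all arguments but the first; and (b) a halting function $\mathrm{halt}\colon\mathbb{N}_{>0}\times\mathbb{R}^*\to\{0,1\}$, invariant under permutations of the tuple in $\mathbb{R}^*$, that is computed by an $\mathfrak{F}_s$-family of arithmetic circuits. On $\mathfrak{G}$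 put $h^{(0)}=g_V$ and $$h^{(i)}(w)=\sigma^{(i)}\Bigl(f^{(i)}\bigl(h^{(i-1)}(w),\{\!\!\{h^{(i-1)}(u)\mid \{u,w\}\in E\}\!\!\}\bigr)\Bigr)\qquad(i\ge 1,\ w\in V).$$ Then $f_{\textit{rec-}\mathcal{N}}(\mathfrak{G})=(V,E,h^{(\ell)})$ for the smallest $\ell\ge 1$ such that $h^{(\ell)}$ is defined on $V$ and $\mathrm{halt}(\ell,\{\!\!\{h^{(\ell)}(v)\mid v\in V\}\!\!\})=1$; if there is none, $f_{\textit{rec-}\mathcal{N}}(\mathfrak{G})$ is undefined. **Theorem.** Let $\mathfrak{F}=\mathrm{FAC}^i_{\mathbb{R}}[\mathcal{B}]$ for some $i\in\mathbb{N}$ and some set $\mathcal{B}$ of functions $\mathbb{R}\to\mathbb{R}$, let $\mathcal{A}$ be a set of functions $\mathbb{R}\to\mathbb{R}$, and let $\textit{rec-}\mathcal{N}$ be a $\mathrm{rec}[t\mathfrak{F}_s]\text{-}(\mathrm{rec}[t\mathfrak{F}_s]\text{-}t\mathfrak{F},\mathcal{A})$-GNN. Then there is a (partial) function $f_{\mathrm{circ}}\in\mathrm{rec}[\mathfrak{F}_s]\text{-}\mathfrak{F}_s[\mathcal{A}]$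 such that for all labelled graphs $\mathfrak{G}$ $$f_{\mathrm{circ}}(\langle\mathfrak{G}\rangle)=\langle f_{\textit{rec-}\mathcal{N}}(\mathfrak{G})\rangle,$$ where one side is defined if and only if the other one is. -/

import Mathlib

namespace RecCirc

noncomputable section

/-! ### Arithmetic circuits -/

/-- The types of gates of a circuit with `n` inputs, `ℓ` auxiliary memory gates and `m` outputs. -/
inductive GateType (n ℓ m : ℕ) : Type
  | input (j : Fin n)
  | aux (j : Fin ℓ)
  | output (j : Fin m)
  | const (c : ℝ)
  | add
  | mul
  | func (f : ℝ → ℝ)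

/-- Extended arithmetic circuits with `n` inputs, `ℓ` auxiliary memory gates and `m` outputs:
finite simple directed acyclic graphs of labelled gates. Addition and multiplication gates have
unbounded fan-in. -/
structure ExtCircuit (n ℓ m : ℕ) where
  Gate : Type
  [fintypeGate : Fintype Gate]
  label : Gate → GateType n ℓ m
  /-- `edge g h`: there is an edge from `g` to `h`. -/
  edge : Gate → Gate → Prop
  acyclic : ∀ g, ¬ Relation.TransGen edge g g
  inGate : Fin n → Gate
  auxGate : Fin ℓ → Gate
  outGate : Fin m → Gate
  label_eq_input : ∀ g j, label g = .input j ↔ g = inGate j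
  label_eq_aux : ∀ g j, label g = .aux j ↔ g = auxGate j
  label_eq_output : ∀ g j, label g = .output j ↔ g = outGate j
  input_source : ∀ j h, ¬ edge h (inGate j)
  aux_source : ∀ j h, ¬ edge h (auxGate j)
  const_source : ∀ g c, label g = .const c → ∀ h, ¬ edge h g
  output_indeg : ∀ j, ∃! h, edge h (outGate j)
  output_outdeg : ∀ j h, ¬ edge (outGate j) h
  func_indeg : ∀ g f, label g = .func f → ∃! h, edge h g
  func_outdeg : ∀ g f, label g = .func f → ∃! h, edge g h

attribute [instance] ExtCircuit.fintypeGate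

/-- Arithmetic circuits: no auxiliary memory gates. -/
abbrev Circuit (n m : ℕ) := ExtCircuit n 0 m

namespace ExtCircuit

variable {n ℓ m : ℕ} (C : ExtCircuit n ℓ m)

theorem wf_edge : WellFounded C.edge := by
  have h : WellFounded (Relation.TransGen C.edge) := by
    have : Std.Irrefl (Relation.TransGen C.edge) := ⟨C.acyclic⟩
    exact Finite.wellFounded_of_trans_of_irrefl _
  exact Subrelation.wf (fun hab => Relation.TransGen.single hab) h

open Classical in
/-- The value of a gate on input `x` with auxiliary memory values `a`. Output gates and function
gates have exactly one predecessor, so that the sums written for them have a single term. -/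
def value (x : Fin n → ℝ) (a : Fin ℓ → ℝ) : C.Gate → ℝ :=
  C.wf_edge.fix fun g rec =>
    match C.label g with
    | .input j => x j
    | .aux j => a j
    | .const c => c
    | .add => ∑ h : {h // C.edge h g}, rec h.1 h.2
    | .mul => ∏ h : {h // C.edge h g}, rec h.1 h.2
    | .output _ => ∑ h : {h // C.edge h g}, rec h.1 h.2
    | .func f => f (∑ h : {h // C.edge h g}, rec h.1 h.2)

/-- The tuple of values of the output gates. -/
def eval (x : Fin n → ℝ) (a : Fin ℓ → ℝ) : Fin m → ℝ :=
  fun j => C.value x a (C.outGate j)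

/-- The number of gates. -/
def size : ℕ := Fintype.card C.Gate

/-- The length (number of edges) of a longest directed path between two gates. -/
def depth : ℕ :=
  sSup {k | ∃ p : List C.Gate, p.IsChain C.edge ∧ p.length = k + 1}

/-- All function gates of the circuit compute functions from `A`. -/
def GatesIn (A : Set (ℝ → ℝ)) : Prop :=
  ∀ g f, C.label g = .func f → f ∈ A

open Classical in
theorem value_eq (x : Fin n → ℝ) (a : Fin ℓ → ℝ) (g : C.Gate) :
    C.value x a g =
      match C.label g with
      | .input j => x j
      | .aux j => a j
      | .const c => c
      | .add => ∑ h : {h // C.edge h g}, C.value x a h.1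
      | .mul => ∏ h : {h // C.edge h g}, C.value x a h.1
      | .output _ => ∑ h : {h // C.edge h g}, C.value x a h.1
      | .func f => f (∑ h : {h // C.edge h g}, C.value x a h.1) := by
  unfold value
  rw [WellFounded.fix_eq]

/-- The supremum in the definition of `depth` is that of a bounded set. -/
theorem bddAbove_depth :
    BddAbove {k | ∃ p : List C.Gate, p.IsChain C.edge ∧ p.length = k + 1} := by
  refine ⟨C.size, ?_⟩
  rintro k ⟨p, hp, hk⟩
  have h1 : p.Pairwise (Relation.TransGen C.edge) :=
    (hp.imp fun _ _ h => Relation.TransGen.single h).pairwise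
  have h2 : p.Nodup := by
    refine List.Pairwise.imp ?_ h1
    rintro a b h rfl
    exact C.acyclic a h
  have h3 : p.length ≤ C.size := h2.length_le_card
  omega

end ExtCircuit

/-! ### Circuit function classes -/

/-- `signFn x = 1` if `x > 0` and `signFn x = 0` otherwise. -/
def signFn (x : ℝ) : ℝ := if 0 < x then 1 else 0

/-- The data `i`, `𝓐` that determine the circuit function class `FAC^i_ℝ[𝓐]`. -/
structure CircuitClass where
  exponent : ℕ
  gates : Set (ℝ → ℝ)

namespace CircuitClass

/-- The class `𝔉[𝓐]`: the gate types of `𝔉` together with those from `𝓐`. -/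
def adjoin (F : CircuitClass) (A : Set (ℝ → ℝ)) : CircuitClass :=
  ⟨F.exponent, F.gates ∪ A⟩

/-- The class `𝔉_s = 𝔉[sign]`. -/
def withSign (F : CircuitClass) : CircuitClass := F.adjoin {signFn}

/-- `C` is an `𝔉`-circuit family: it has polynomial size, depth `O((log n)^i)`, and its function
gates are among those of `𝔉`. -/
def IsFamily (F : CircuitClass) {ℓ m : ℕ → ℕ} (C : ∀ n, ExtCircuit n (ℓ n) (m n)) : Prop :=
  (∀ n, (C n).GatesIn F.gates) ∧
  (∃ k : ℕ, (fun n => ((C n).size : ℝ)) =O[Filter.atTop] fun n : ℕ => (n : ℝ) ^ k) ∧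
  (fun n => ((C n).depth : ℝ)) =O[Filter.atTop] fun n : ℕ => Real.log n ^ F.exponent

end CircuitClass

/-- The arithmetic circuit `D` computes the halting function `halt`; its first input is the
iteration number. -/
def ComputesHalt {p : ℕ} (D : Circuit (p + 1) 1) (halt : ℕ+ → (Fin p → ℝ) → Bool) : Prop :=
  ∀ (i : ℕ+) (v : Fin p → ℝ),
    D.eval (Fin.cons ((i : ℕ) : ℝ) v) Fin.elim0 0 = if halt i v = true then 1 else 0

/-! ### Recurrent circuits -/

/-- Recurrent arithmetic circuits with `n` inputs and `m` outputs. The recurrent edges, exactly one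
into each memory gate, are given by their sources `recIn`, `recAux`; output gates have fan-out
zero, so they are no such sources. The `numHalt` halting gates are pairwise distinct and ordered. -/
structure RecCircuit (n m : ℕ) where
  numAux : ℕ
  circ : ExtCircuit n numAux m
  init : Fin numAux → ℝ
  recIn : Fin n → circ.Gate
  recAux : Fin numAux → circ.Gate
  recIn_ne : ∀ j k, recIn j ≠ circ.outGate k
  recAux_ne : ∀ j k, recAux j ≠ circ.outGate k
  numHalt : ℕ
  haltGate : Fin numHalt ↪ circ.Gate
  halt : ℕ+ → (Fin numHalt → ℝ) → Bool

namespace RecCircuit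

variable {n m : ℕ} (R : RecCircuit n m)

/-- The values of the input and auxiliary memory gates after `k` updates, on input `x`. -/
def memory (x : Fin n → ℝ) : ℕ → (Fin n → ℝ) × (Fin R.numAux → ℝ)
  | 0 => (x, R.init)
  | k + 1 =>
    let s := memory x k
    (fun j => R.circ.value s.1 s.2 (R.recIn j), fun j => R.circ.value s.1 s.2 (R.recAux j))

/-- The halting function evaluates to `1` in iteration `k + 1`. -/
def HaltsAt (x : Fin n → ℝ) (k : ℕ) : Prop :=
  R.halt k.succPNat
    (fun j => R.circ.value (R.memory x k).1 (R.memory x k).2 (R.haltGate j)) = true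

open Classical in
/-- The partial function computed by a recurrent circuit: the output values of the first iteration
in which the halting function evaluates to `1`. -/
def eval (x : Fin n → ℝ) : Part (Fin m → ℝ) :=
  Part.assert (∃ k, R.HaltsAt x k) fun h =>
    Part.some (R.circ.eval (R.memory x (Nat.find h)).1 (R.memory x (Nat.find h)).2)

end RecCircuit

/-- Recurrent circuit families. -/
structure RecFamily where
  numOut : ℕ → ℕ
  circuit : ∀ n, RecCircuit n (numOut n)

/-- The partial function `ℝ* → ℝ*` computed by a recurrent circuit family. -/
def RecFamily.eval (R : RecFamily) : List ℝ →. List ℝ :=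
  fun x => ((R.circuit x.length).eval x.get).map List.ofFn

/-- The recurrent circuit function class `rec[𝔉halt]-𝔉`: the (partial) functions computed by
recurrent circuit families whose underlying circuits form an `𝔉`-family and whose halting functions
are all members of one family of functions computed by an `𝔉halt`-family. -/
def recClass (Fhalt F : CircuitClass) : Set (List ℝ →. List ℝ) :=
  {f | ∃ R : RecFamily,
    F.IsFamily (fun n => (R.circuit n).circ) ∧
    (∃ D : ∀ k, Circuit k 1, Fhalt.IsFamily D ∧
      ∀ n, ComputesHalt (D ((R.circuit n).numHalt + 1)) (R.circuit n).halt) ∧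
    R.eval = f}

/-! ### Labelled graphs -/

/-- Labelled graphs. The ordered vertex set is `Fin order`. -/
structure LabelledGraph where
  order : ℕ
  graph : SimpleGraph (Fin order)
  feature : Fin order → ℝ

namespace LabelledGraph

open Classical in
/-- The encoding of a labelled graph: the rows of the adjacency matrix, then the features. -/
def encode (G : LabelledGraph) : List ℝ :=
  (List.ofFn fun v => List.ofFn fun w => if G.graph.Adj v w then (1 : ℝ) else 0).flatten ++
    List.ofFn G.feature

open Classical in
/-- The features, under the labelling `h`, of the neighbours of `w`, in the order of the
vertices. -/
def neighbourFeatures (G : LabelledGraph) (h : Fin G.order → ℝ) (w : Fin G.order) : List ℝ :=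
  ((List.finRange G.order).filter fun u => G.graph.Adj w u).map h

end LabelledGraph

/-! ### Recurrent circuit graph neural networks -/

/-- Invariance under permutations of all arguments but the first one. -/
def TailSymmetric (f : List ℝ →. ℝ) : Prop :=
  ∀ (x : ℝ) (l l' : List ℝ), l.Perm l' → f (x :: l) = f (x :: l')

/-- The tail-symmetric functions of the class `rec[𝔉halt]-𝔉` with one real output. -/
def tailRecClass (Fhalt F : CircuitClass) : Set (List ℝ →. ℝ) :=
  {f | TailSymmetric f ∧ (fun x => (f x).map fun y => [y]) ∈ recClass Fhalt F}

/-- Halting functions of networks that are tail-symmetric and belong to the class `𝔉`. -/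
def tailHaltClass (F : CircuitClass) : Set (ℕ+ → List ℝ → Bool) :=
  {halt | (∀ (i : ℕ+) (l l' : List ℝ), l.Perm l' → halt i l = halt i l') ∧
    ∃ D : ∀ k, Circuit k 1, F.IsFamily D ∧
      ∀ p : ℕ, ComputesHalt (D (p + 1)) fun i (v : Fin p → ℝ) => halt i (List.ofFn v)}

/-- The data of a recurrent circuit graph neural network: `layer i` consists of the function and
the activation function of the `i`th layer. -/
structure RecGNN where
  layer : ℕ → (List ℝ →. ℝ) × (ℝ → ℝ)
  halt : ℕ+ → List ℝ → Bool

namespace RecGNN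

/-- `N` is a `rec[t𝔉o]-(rec[t𝔉i]-t𝔉, 𝓐)`-GNN, with outer halting class `𝔉o` and inner halting
class `𝔉i`. -/
def IsOfType (N : RecGNN) (Fo Fi F : CircuitClass) (A : Set (ℝ → ℝ)) : Prop :=
  (∃ d, 0 < d ∧ Function.Periodic N.layer d) ∧
  (∀ i, (N.layer i).1 ∈ tailRecClass Fi F ∧ (N.layer i).2 ∈ A) ∧
  N.halt ∈ tailHaltClass Fo

/-- The labelling after `i` layers; undefined if some function evaluated on the way is. -/
def features (N : RecGNN) (G : LabelledGraph) : ℕ → Part (Fin G.order → ℝ)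
  | 0 => Part.some G.feature
  | i + 1 => (features N G i).bind fun h =>
      ⟨∀ w, ((N.layer (i + 1)).1 (h w :: G.neighbourFeatures h w)).Dom,
        fun hd w => (N.layer (i + 1)).2
          (((N.layer (i + 1)).1 (h w :: G.neighbourFeatures h w)).get (hd w))⟩

/-- The halting function evaluates to `1` after layer `k + 1`. -/
def HaltsAt (N : RecGNN) (G : LabelledGraph) (k : ℕ) : Prop :=
  ∃ h ∈ N.features G (k + 1), N.halt k.succPNat (List.ofFn h) = true

open Classical in
/-- The partial function from labelled graphs to labelled graphs computed by the network. -/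
def eval (N : RecGNN) : LabelledGraph →. LabelledGraph :=
  fun G => Part.assert (∃ k, N.HaltsAt G k) fun hk =>
    (N.features G (Nat.find hk + 1)).map fun h => ⟨G.order, G.graph, h⟩

end RecGNN

end

end RecCirc

/-! For graphs with `n` vertices the circuit has `n² + n` inputs. In each of its iterations it
performs one iteration of the inner recurrent circuits of all vertices at once. The circuit is fixed
before the graph is known, so it carries a copy of the inner circuit for every vertex, every residue
of the layer number modulo the period, and every degree below `n`: polynomially many copies.
Indicators built from `sign` and the adjacency matrix select the one copy per vertex that matters
(`sel`). They also extract the neighbour features: the `j`th neighbour of `w` is the neighbour with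
exactly `j` neighbours of `w` before it (`nbr`). The remaining copies hold meaningless real numbers,
which get multiplied by 0.

The inner computations of one layer may take different numbers of iterations, so a copy that has
halted is frozen (`frozenStep`) and waits. Once all selected copies have halted, the product
`allHalted` is 1. In that same iteration the activation functions are applied, the outer halting
function is consulted, the features are replaced, the residue indicator is shifted cyclically, and a
flag makes the next iteration start from freshly loaded initial states. If an inner computation
diverges, `allHalted` stays 0 from then on and the circuit never halts.

Correctness rests on the invariant `Simulates`, which `next_of_not_done` and `next_of_done`
propagate; `result_of_first_halting` and `exists_halting` derive both directions of the equivalence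
from it.

The resource bounds come from a calculus of families that are uniformly of polynomial size and depth
`O((log n)^i)` (`Feasible`). It is closed under substitution, sums and products, and the step map
`next` arises from boundedly many of these operations. The calculus runs on nets, which have no
fan-out restrictions; `Net.toCircuit` turns a net into a circuit while about doubling size and
depth, and `exists_recCircuit` turns a feasible dynamical system into a recurrent circuit. -/

namespace RecCirc

noncomputable section

/-! ### Nets: circuits without fan-out restrictions and without output gates -/

/-- The operations of a net with inputs `I` and gates `G`, together with their operands. -/
inductive NetOp (I G : Type) : Type
  | input (i : I)
  | const (c : ℝ)
  | add (S : Finset G)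
  | mul (S : Finset G)
  | func (f : ℝ → ℝ) (g : G)

namespace NetOp

variable {I J G H : Type}

/-- The value of an operation on input `x` if the gates have the values `v`. -/
def eval (x : I → ℝ) (v : G → ℝ) : NetOp I G → ℝ
  | input i => x i
  | const c => c
  | add S => ∑ g ∈ S, v g
  | mul S => ∏ g ∈ S, v g
  | func f g => f (v g)

/-- The operands of an operation. -/
def preds : NetOp I G → Finset G
  | input _ => ∅
  | const _ => ∅
  | add S => S
  | mul S => S
  | func _ g => {g}

/-- Renaming the gates and replacing the inputs by operations. -/
def bind (φ : G ↪ H) (ψ : I → NetOp J H) : NetOp I G → NetOp J H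
  | input i => ψ i
  | const c => const c
  | add S => add (S.map φ)
  | mul S => mul (S.map φ)
  | func f g => func f (φ g)

theorem eval_bind (φ : G ↪ H) (ψ : I → NetOp J H) (y : J → ℝ) (v : H → ℝ) (o : NetOp I G) :
    (o.bind φ ψ).eval y v = o.eval (fun i => (ψ i).eval y v) (fun g => v (φ g)) := by
  cases o <;> simp [bind, eval]

theorem mem_preds_bind {φ : G ↪ H} {ψ : I → NetOp J H} {o : NetOp I G} {h : H}
    (hh : h ∈ (o.bind φ ψ).preds) :
    (∃ g ∈ o.preds, φ g = h) ∨ ∃ i, o = input i ∧ h ∈ (ψ i).preds := by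
  cases o <;> simp_all [bind, preds]

theorem bind_eq_func {φ : G ↪ H} {ψ : I → NetOp J H} {o : NetOp I G} {f : ℝ → ℝ} {h : H}
    (hh : o.bind φ ψ = func f h) :
    (∃ g, o = func f g) ∨ ∃ i, ψ i = func f h := by
  cases o with
  | input i => exact Or.inr ⟨i, hh⟩
  | func f' g => exact Or.inl ⟨g, by simp_all [bind]⟩
  | _ => simp [bind] at hh

end NetOp

/-- Finite directed acyclic graphs of operations, with function gates from `B`. -/
structure Net (B : Set (ℝ → ℝ)) (I : Type) where
  Gate : Type
  [fintypeGate : Fintype Gate]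
  op : Gate → NetOp I Gate
  rank : Gate → ℕ
  rank_lt : ∀ g, ∀ h ∈ (op g).preds, rank h < rank g
  func_mem : ∀ g f h, op g = .func f h → f ∈ B

attribute [instance] Net.fintypeGate

/-- `v` assigns to the gates of the net their values on input `x`. -/
def Net.IsValuation {B : Set (ℝ → ℝ)} {I : Type} (N : Net B I) (x : I → ℝ) (v : N.Gate → ℝ) :
    Prop :=
  ∀ g, v g = (N.op g).eval x v

/-- The function `f` is computed by a net with at most `s` gates and depth at most `d`. -/
def NetComputable (B : Set (ℝ → ℝ)) {I : Type} (f : (I → ℝ) → ℝ) (s d : ℕ) : Prop :=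
  ∃ (N : Net B I) (o : N.Gate), (∀ x, ∃ v, N.IsValuation x v ∧ v o = f x) ∧
    Fintype.card N.Gate ≤ s ∧ ∀ g, N.rank g ≤ d

namespace NetComputable

variable {B : Set (ℝ → ℝ)} {I M : Type}

theorem mono {f : (I → ℝ) → ℝ} {s d s' d' : ℕ} (h : NetComputable B f s d) (hs : s ≤ s')
    (hd : d ≤ d') : NetComputable B f s' d' := by
  obtain ⟨N, o, h1, h2, h3⟩ := h
  exact ⟨N, o, h1, h2.trans hs, fun g => (h3 g).trans hd⟩

theorem var (i : I) : NetComputable B (fun x => x i) 1 0 :=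
  ⟨{ Gate := Unit
     op := fun _ => .input i
     rank := fun _ => 0
     rank_lt := by simp [NetOp.preds]
     func_mem := by simp }, (), fun x => ⟨fun _ => x i, fun _ => rfl, rfl⟩, by simp, by simp⟩

theorem const (c : ℝ) : NetComputable B (fun _ : I → ℝ => c) 1 0 :=
  ⟨{ Gate := Unit
     op := fun _ => .const c
     rank := fun _ => 0
     rank_lt := by simp [NetOp.preds]
     func_mem := by simp }, (), fun _ => ⟨fun _ => c, fun _ => rfl, rfl⟩, by simp, by simp⟩

/-- A single operation applied to the inputs. -/
theorem of_op [Fintype I] (o : NetOp Empty I) (hB : ∀ f i, o = .func f i → f ∈ B) :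
    NetComputable B (fun x : I → ℝ => o.eval Empty.elim x) (Fintype.card I + 1) 1 := by
  refine ⟨{ Gate := Option I
            op := fun g => g.elim (o.bind Function.Embedding.some Empty.elim) .input
            rank := fun g => g.elim 1 fun _ => 0
            rank_lt := ?_
            func_mem := ?_ }, none, fun x => ⟨fun g => g.elim (o.eval Empty.elim x) x, ?_, rfl⟩,
            by simp, ?_⟩
  · rintro (_ | g) h hh
    · rcases NetOp.mem_preds_bind hh with ⟨g, -, rfl⟩ | ⟨i, -⟩
      · simp
      · exact i.elim
    · simp [NetOp.preds] at hh
  · rintro (_ | g) f h hh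
    · rcases NetOp.bind_eq_func hh with ⟨g, hg⟩ | ⟨i, -⟩
      · exact hB _ _ hg
      · exact i.elim
    · simp at hh
  · rintro (_ | g)
    · simp only [Option.elim_none, NetOp.eval_bind]
      congr 1
      exact funext fun i => i.elim
    · rfl
  · rintro (_ | g) <;> simp

theorem sum [Fintype I] : NetComputable B (fun x : I → ℝ => ∑ i, x i) (Fintype.card I + 1) 1 :=
  of_op (.add Finset.univ) (by simp)

theorem prod [Fintype I] : NetComputable B (fun x : I → ℝ => ∏ i, x i) (Fintype.card I + 1) 1 :=
  of_op (.mul Finset.univ) (by simp)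

theorem func {f : ℝ → ℝ} (hf : f ∈ B) : NetComputable B (fun x : Unit → ℝ => f (x ())) 2 1 :=
  of_op (.func f ()) (by rintro g _ ⟨⟩; exact hf)

theorem rename {J : Type} (φ : I → J) {f : (I → ℝ) → ℝ} {s d : ℕ} (h : NetComputable B f s d) :
    NetComputable B (fun y => f fun i => y (φ i)) s d := by
  obtain ⟨N, o, h1, h2, h3⟩ := h
  refine ⟨{ Gate := N.Gate
            op := fun g => (N.op g).bind (.refl _) fun i => .input (φ i)
            rank := N.rank
            rank_lt := ?_
            func_mem := ?_ }, o, fun y => ?_, h2, h3⟩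
  · intro g h hh
    rcases NetOp.mem_preds_bind hh with ⟨g', hg', rfl⟩ | ⟨i, -, hi⟩
    · exact N.rank_lt _ _ hg'
    · simp [NetOp.preds] at hi
  · intro g f h hh
    rcases NetOp.bind_eq_func hh with ⟨g', hg'⟩ | ⟨i, hi⟩
    · exact N.func_mem _ _ _ hg'
    · simp at hi
  · obtain ⟨v, v1, v2⟩ := h1 fun i => y (φ i)
    refine ⟨v, fun g => ?_, v2⟩
    simp only [NetOp.eval_bind]
    exact v1 g

/-- Finitely many functions computed by nets are computed by a common one. -/
theorem exists_net [Fintype M] {g : M → (I → ℝ) → ℝ} {s d : ℕ}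
    (hg : ∀ m, NetComputable B (g m) s d) :
    ∃ (N : Net B I) (o : M → N.Gate),
      (∀ x, ∃ v, N.IsValuation x v ∧ ∀ m, v (o m) = g m x) ∧
      Fintype.card N.Gate ≤ Fintype.card M * s ∧ ∀ g, N.rank g ≤ d := by
  choose K q k1 k2 k3 using hg
  refine ⟨{ Gate := Σ m, (K m).Gate
            op := fun p => ((K p.1).op p.2).bind (Function.Embedding.sigmaMk p.1) .input
            rank := fun p => (K p.1).rank p.2
            rank_lt := ?_
            func_mem := ?_ }, fun m => ⟨m, q m⟩, fun x => ?_, ?_, fun p => k3 p.1 p.2⟩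
  · rintro ⟨m, g⟩ h hh
    rcases NetOp.mem_preds_bind hh with ⟨g', hg', rfl⟩ | ⟨i, -, hi⟩
    · exact (K m).rank_lt _ _ hg'
    · simp [NetOp.preds] at hi
  · rintro ⟨m, g⟩ f h hh
    rcases NetOp.bind_eq_func hh with ⟨g', hg'⟩ | ⟨i, hi⟩
    · exact (K m).func_mem _ _ _ hg'
    · simp at hi
  · choose u u1 u2 using fun m => k1 m x
    refine ⟨fun p => u p.1 p.2, ?_, u2⟩
    rintro ⟨m, g'⟩
    simp only [NetOp.eval_bind]
    exact u1 m g'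
  · rw [Fintype.card_sigma]
    have : ∑ m, Fintype.card (K m).Gate ≤ ∑ _m : M, s := Finset.sum_le_sum fun m _ => k2 m
    simpa using this

theorem subst [Fintype M] {f : (M → ℝ) → ℝ} {g : M → (I → ℝ) → ℝ} {s d s' d' : ℕ}
    (hf : NetComputable B f s d) (hg : ∀ m, NetComputable B (g m) s' d') :
    NetComputable B (fun x => f fun m => g m x) (s + Fintype.card M * s') (d + d' + 1) := by
  obtain ⟨N, o, h1, h2, h3⟩ := hf
  obtain ⟨K, q, k1, k2, k3⟩ := exists_net hg
  -- An input of the outer net becomes an addition gate with a single summand, which copies a value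
  -- of the inner net. These gates account for the extra level in the depth.
  let ψ : M → NetOp I (K.Gate ⊕ N.Gate) := fun m => .add {Sum.inl (q m)}
  refine ⟨{ Gate := K.Gate ⊕ N.Gate
            op := Sum.elim (fun g => (K.op g).bind Function.Embedding.inl .input)
              (fun g => (N.op g).bind Function.Embedding.inr ψ)
            rank := Sum.elim K.rank (fun g => d' + 1 + N.rank g)
            rank_lt := ?_
            func_mem := ?_ }, Sum.inr o, fun x => ?_, ?_, ?_⟩
  · rintro (g | g) h hh
    · rcases NetOp.mem_preds_bind hh with ⟨g', hg', rfl⟩ | ⟨i, -, hi⟩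
      · exact K.rank_lt _ _ hg'
      · simp [NetOp.preds] at hi
    · rcases NetOp.mem_preds_bind hh with ⟨g', hg', rfl⟩ | ⟨i, -, hi⟩
      · simpa using N.rank_lt _ _ hg'
      · simp only [ψ, NetOp.preds, Finset.mem_singleton] at hi
        subst hi
        have := k3 (q i)
        simp only [Sum.elim_inl, Sum.elim_inr]
        omega
  · rintro (g | g) f h hh
    · rcases NetOp.bind_eq_func hh with ⟨g', hg'⟩ | ⟨i, hi⟩
      · exact K.func_mem _ _ _ hg'
      · simp at hi
    · rcases NetOp.bind_eq_func hh with ⟨g', hg'⟩ | ⟨i, hi⟩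
      · exact N.func_mem _ _ _ hg'
      · simp [ψ] at hi
  · obtain ⟨u, u1, u2⟩ := k1 x
    obtain ⟨v, v1, v2⟩ := h1 fun m => g m x
    refine ⟨Sum.elim u v, ?_, v2⟩
    rintro (g' | g')
    · simp only [Sum.elim_inl, NetOp.eval_bind]
      exact u1 g'
    · simp only [Sum.elim_inr, NetOp.eval_bind]
      rw [v1 g']
      simp [ψ, NetOp.eval, u2]
  · simp only [Fintype.card_sum]
    omega
  · rintro (g | g)
    · have := k3 g
      simp only [Sum.elim_inl]
      omega
    · have := h3 g
      simp only [Sum.elim_inr]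
      omega

end NetComputable

/-! ### Circuits as nets -/

namespace ExtCircuit

variable {n ℓ m : ℕ} (C : ExtCircuit n ℓ m)

theorem auxGate_injective : Function.Injective C.auxGate := fun j k h => by
  have h1 := (C.label_eq_aux _ j).2 rfl
  rw [(C.label_eq_aux _ k).2 h] at h1
  exact (GateType.aux.inj h1).symm

/-- The length of a longest directed path that ends in `g`. -/
def height (g : C.Gate) : ℕ :=
  sSup {k | ∃ p : List C.Gate, (p ++ [g]).IsChain C.edge ∧ p.length = k}

theorem height_bdd (g : C.Gate) :
    ∀ k ∈ {k | ∃ p : List C.Gate, (p ++ [g]).IsChain C.edge ∧ p.length = k}, k ≤ C.depth := by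
  rintro k ⟨p, hp, rfl⟩
  exact le_csSup C.bddAbove_depth ⟨p ++ [g], hp, by simp⟩

theorem height_nonempty (g : C.Gate) :
    {k | ∃ p : List C.Gate, (p ++ [g]).IsChain C.edge ∧ p.length = k}.Nonempty :=
  ⟨0, [], by simp, rfl⟩

theorem height_le (g : C.Gate) : C.height g ≤ C.depth :=
  csSup_le (C.height_nonempty g) (C.height_bdd g)

theorem height_lt {g h : C.Gate} (e : C.edge g h) : C.height g < C.height h := by
  obtain ⟨p, hp, hk⟩ := Nat.sSup_mem (C.height_nonempty g) ⟨_, C.height_bdd g⟩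
  refine Nat.lt_of_succ_le (le_csSup ⟨_, C.height_bdd h⟩ ⟨p ++ [g], ?_, ?_⟩)
  · rw [List.isChain_append]
    refine ⟨hp, by simp, ?_⟩
    simpa using e
  · simpa [height] using hk

open Classical in
/-- The operation performed by a gate. -/
def netOp (g : C.Gate) : NetOp (Fin n ⊕ Fin ℓ) C.Gate :=
  match hg : C.label g with
  | .input j => .input (.inl j)
  | .aux j => .input (.inr j)
  | .const c => .const c
  | .add => .add {h | C.edge h g}
  | .mul => .mul {h | C.edge h g}
  | .output _ => .add {h | C.edge h g}
  | .func f => .func f (C.func_indeg g f hg).choose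

theorem edge_of_mem_preds {g h : C.Gate} (hh : h ∈ (C.netOp g).preds) : C.edge h g := by
  unfold netOp at hh
  split at hh
  all_goals first
    | simp [NetOp.preds] at hh; done
    | simpa [NetOp.preds] using hh
    | skip
  next f hg =>
    simp only [NetOp.preds, Finset.mem_singleton] at hh
    rw [hh]
    exact (C.func_indeg g f hg).choose_spec.1

theorem label_of_netOp_func {g h : C.Gate} {f : ℝ → ℝ} (hh : C.netOp g = .func f h) :
    C.label g = .func f := by
  unfold netOp at hh
  split at hh <;> simp_all

theorem value_eq_netOp (x : Fin n → ℝ) (a : Fin ℓ → ℝ) (g : C.Gate) :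
    C.value x a g = (C.netOp g).eval (Sum.elim x a) (C.value x a) := by
  classical
  have key : ∀ F : C.Gate → ℝ, ∑ h : {h // C.edge h g}, F h.1 = ∑ h with C.edge h g, F h := by
    intro F
    rw [← Finset.sum_subtype_eq_sum_filter, Finset.subtype_univ]
  rw [C.value_eq]
  unfold netOp
  split <;> rename_i hg
  · split <;> simp_all [NetOp.eval]
  · split <;> simp_all [NetOp.eval]
  · split <;> simp_all [NetOp.eval]
  · split <;> simp_all [NetOp.eval]
  · split <;> simp_all [NetOp.eval]
    rw [← Finset.prod_subtype_eq_prod_filter, Finset.subtype_univ]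
  · split <;> simp_all [NetOp.eval]
  · rename_i f
    split <;> simp_all [NetOp.eval]
    rename_i f' hg'
    congr 1
    have hs := (C.func_indeg g f' hg').choose_spec
    -- The predecessor of a function gate is unique, so the sum has one term, at the chosen
    -- predecessor.
    rw [Finset.sum_eq_single_of_mem (C.func_indeg g f' hg').choose (by simpa using hs.1)]
    intro b hb hne
    exact absurd (hs.2 b (by simpa using hb)) hne

theorem netComputable_value {B : Set (ℝ → ℝ)} (hB : C.GatesIn B) (g : C.Gate) :
    NetComputable B (fun s : Fin n ⊕ Fin ℓ → ℝ => C.value (s ∘ Sum.inl) (s ∘ Sum.inr) g)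
      C.size C.depth :=
  ⟨{ Gate := C.Gate
     op := C.netOp
     rank := C.height
     rank_lt := fun _ _ hh => C.height_lt (C.edge_of_mem_preds hh)
     func_mem := fun _ _ _ hh => hB _ _ (C.label_of_netOp_func hh) }, g,
    fun s => ⟨C.value (s ∘ Sum.inl) (s ∘ Sum.inr), fun g => by
      rw [C.value_eq_netOp, Sum.elim_comp_inl_inr], rfl⟩, le_rfl, C.height_le⟩

/-- The rank grows by at least one along each edge, so a path is no longer than the rank of its last
gate allows. -/
theorem depth_le_of_rank {d : ℕ} (r : C.Gate → ℕ) (hr : ∀ g h, C.edge g h → r g < r h)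
    (hd : ∀ g, r g ≤ d) : C.depth ≤ d := by
  refine csSup_le' ?_
  rintro k ⟨p, hp, hk⟩
  have key : ∀ (p : List C.Gate), p.IsChain C.edge → ∀ g ∈ p.getLast?, p.length ≤ r g + 1 := by
    intro p
    induction p using List.reverseRecOn with
    | nil => simp
    | append_singleton l a ih =>
      intro hc g hg
      simp only [List.getLast?_append, List.getLast?_singleton, Option.some_or,
        Option.mem_def, Option.some.injEq] at hg
      subst hg
      rw [List.isChain_append] at hc
      cases hl : l.getLast? with
      | none => simp [List.getLast?_eq_none_iff.1 hl]
      | some b =>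
        have h1 := ih hc.1 b hl
        have h2 := hr b a (hc.2.2 b hl a (by simp))
        simp only [List.length_append, List.length_singleton]
        omega
  cases hl : p.getLast? with
  | none => simp [List.getLast?_eq_none_iff.1 hl] at hk
  | some b =>
    have h1 := key p hp b hl
    have h2 := hd b
    omega

end ExtCircuit

/-! ### Nets as circuits -/

namespace ExtCircuit

variable {n ℓ m : ℕ} (C : ExtCircuit n ℓ m) {x : Fin n → ℝ} {a : Fin ℓ → ℝ} {g : C.Gate}

theorem value_of_input {j : Fin n} (hg : C.label g = .input j) : C.value x a g = x j := by
  rw [C.value_eq, hg]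

theorem value_of_aux {j : Fin ℓ} (hg : C.label g = .aux j) : C.value x a g = a j := by
  rw [C.value_eq, hg]

theorem value_of_const {c : ℝ} (hg : C.label g = .const c) : C.value x a g = c := by
  rw [C.value_eq, hg]

theorem value_of_add {S : Finset C.Gate} (hg : C.label g = .add) (hS : ∀ h, h ∈ S ↔ C.edge h g) :
    C.value x a g = ∑ h ∈ S, C.value x a h := by
  rw [C.value_eq, hg, Finset.sum_subtype S hS]

theorem value_of_mul {S : Finset C.Gate} (hg : C.label g = .mul) (hS : ∀ h, h ∈ S ↔ C.edge h g) :
    C.value x a g = ∏ h ∈ S, C.value x a h := by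
  rw [C.value_eq, hg, Finset.prod_subtype S hS]

theorem value_of_output {j : Fin m} {h : C.Gate} (hg : C.label g = .output j)
    (hS : ∀ h', C.edge h' g ↔ h' = h) : C.value x a g = C.value x a h := by
  rw [C.value_eq, hg]
  simp only
  rw [← Finset.sum_subtype {h} (fun h' => by simp [hS]), Finset.sum_singleton]

theorem value_of_func {f : ℝ → ℝ} {h : C.Gate} (hg : C.label g = .func f)
    (hS : ∀ h', C.edge h' g ↔ h' = h) : C.value x a g = f (C.value x a h) := by
  rw [C.value_eq, hg]
  simp only
  rw [← Finset.sum_subtype {h} (fun h' => by simp [hS]), Finset.sum_singleton]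

end ExtCircuit

/-- The gates of the circuit of a net: memory gates, output gates, and for every gate of the net a
gate for its operation and one that copies the value of the latter. -/
inductive NetGate (n ℓ m : ℕ) (G : Type) : Type
  | mem (i : Fin n ⊕ Fin ℓ)
  | out (j : Fin m)
  | comp (g : G)
  | copy (g : G)

namespace NetGate

variable (n ℓ m : ℕ) (G : Type)

/-- The gates of the circuit of a net as a sum type. -/
def equivSum : (Fin n ⊕ Fin ℓ) ⊕ (Fin m ⊕ (G ⊕ G)) ≃ NetGate n ℓ m G where
  toFun := Sum.elim mem (Sum.elim out (Sum.elim comp copy))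
  invFun
    | mem i => .inl i
    | out j => .inr (.inl j)
    | comp g => .inr (.inr (.inl g))
    | copy g => .inr (.inr (.inr g))
  left_inv := by rintro (i | j | g | g) <;> rfl
  right_inv := by rintro (i | j | g | g) <;> rfl

instance [Fintype G] : Fintype (NetGate n ℓ m G) := Fintype.ofEquiv _ (equivSum n ℓ m G)

theorem card_eq [Fintype G] :
    Fintype.card (NetGate n ℓ m G) = n + ℓ + m + 2 * Fintype.card G := by
  rw [← Fintype.card_congr (equivSum n ℓ m G)]
  simp only [Fintype.card_sum, Fintype.card_fin]
  ring

variable {n ℓ m G}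

/-- The label of the gate for an operation. -/
def opLabel {I : Type} : NetOp I G → GateType n ℓ m
  | .input _ => .add
  | .const c => .const c
  | .add _ => .add
  | .mul _ => .mul
  | .func f _ => .func f

/-- The predecessors of the gate for an operation. -/
def opPreds : NetOp (Fin n ⊕ Fin ℓ) G → Set (NetGate n ℓ m G)
  | .input i => {mem i}
  | .const _ => ∅
  | .add S => {h | ∃ g ∈ S, h = copy g}
  | .mul S => {h | ∃ g ∈ S, h = copy g}
  | .func _ g => {copy g}

theorem mem_opPreds {o : NetOp (Fin n ⊕ Fin ℓ) G} {h : NetGate n ℓ m G} (hh : h ∈ opPreds o) :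
    (∃ i, h = mem i) ∨ ∃ g ∈ o.preds, h = copy g := by
  cases o <;> simp_all [opPreds, NetOp.preds]

end NetGate

namespace Net

open NetGate

variable {B : Set (ℝ → ℝ)} {n ℓ m : ℕ} (N : Net B (Fin n ⊕ Fin ℓ)) (out : Fin m → N.Gate)

/-- The labels of the circuit of a net. -/
def circuitLabel : NetGate n ℓ m N.Gate → GateType n ℓ m
  | .mem (.inl j) => .input j
  | .mem (.inr j) => .aux j
  | .out j => .output j
  | .comp g => opLabel (N.op g)
  | .copy _ => .add

/-- The edges of the circuit of a net. -/
def circuitEdge (h : NetGate n ℓ m N.Gate) : NetGate n ℓ m N.Gate → Prop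
  | .mem _ => False
  | .out j => h = .copy (out j)
  | .comp g => h ∈ opPreds (N.op g)
  | .copy g => h = .comp g

/-- A rank function for the circuit of a net of depth at most `d`. -/
def circuitRank (d : ℕ) : NetGate n ℓ m N.Gate → ℕ
  | .mem _ => 0
  | .out _ => 2 * d + 3
  -- Each level of the net becomes two levels: odd ranks for operations, even ranks for their
  -- copies. Memory gates lie below all of them and output gates above.
  | .comp g => 2 * N.rank g + 1
  | .copy g => 2 * N.rank g + 2

theorem circuitRank_le {d : ℕ} (hd : ∀ g, N.rank g ≤ d) (g : NetGate n ℓ m N.Gate) :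
    N.circuitRank d g ≤ 2 * d + 3 := by
  cases g with
  | mem i => simp [circuitRank]
  | out j => simp [circuitRank]
  | comp g => have := hd g; simp only [circuitRank]; omega
  | copy g => have := hd g; simp only [circuitRank]; omega

theorem circuitRank_lt {d : ℕ} (hd : ∀ g, N.rank g ≤ d) {g h : NetGate n ℓ m N.Gate}
    (e : N.circuitEdge out g h) : N.circuitRank d g < N.circuitRank d h := by
  cases h with
  | mem i => exact e.elim
  | out j =>
    have := hd (out j)
    simp only [circuitEdge] at e
    subst e
    simp only [circuitRank]
    omega
  | comp h =>
    rcases mem_opPreds e with ⟨i, rfl⟩ | ⟨g, hg, rfl⟩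
    · simp [circuitRank]
    · have := N.rank_lt h g hg
      simp only [circuitRank]
      omega
  | copy h =>
    simp only [circuitEdge] at e
    subst e
    simp [circuitRank]

theorem opLabel_eq_func {o : NetOp (Fin n ⊕ Fin ℓ) N.Gate} {f : ℝ → ℝ}
    (h : opLabel o = (.func f : GateType n ℓ m)) : ∃ g, o = .func f g := by
  cases o <;> simp_all [opLabel]

theorem circuitLabel_eq_func {g : NetGate n ℓ m N.Gate} {f : ℝ → ℝ}
    (h : N.circuitLabel g = .func f) : ∃ g' h', g = .comp g' ∧ N.op g' = .func f h' := by
  rcases g with (j | j) | j | g | g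
  all_goals try simp [circuitLabel] at h
  obtain ⟨h', hh⟩ := N.opLabel_eq_func h
  exact ⟨g, h', rfl, hh⟩

/-- The circuit of a net. -/
abbrev toCircuit : ExtCircuit n ℓ m where
  Gate := NetGate n ℓ m N.Gate
  label := N.circuitLabel
  edge := N.circuitEdge out
  acyclic g h := by
    have hd : ∀ g, N.rank g ≤ Finset.univ.sup N.rank := fun g => Finset.le_sup (Finset.mem_univ g)
    have key : ∀ h, Relation.TransGen (N.circuitEdge out) g h →
        N.circuitRank (Finset.univ.sup N.rank) g < N.circuitRank (Finset.univ.sup N.rank) h := by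
      intro h hh
      induction hh with
      | single e => exact N.circuitRank_lt out hd e
      | tail _ e ih => exact ih.trans (N.circuitRank_lt out hd e)
    exact lt_irrefl _ (key g h)
  inGate j := .mem (.inl j)
  auxGate j := .mem (.inr j)
  outGate := .out
  label_eq_input g j := by
    rcases g with (k | k) | k | g | g <;> simp [circuitLabel]
    cases N.op g <;> simp [opLabel]
  label_eq_aux g j := by
    rcases g with (k | k) | k | g | g <;> simp [circuitLabel]
    cases N.op g <;> simp [opLabel]
  label_eq_output g j := by
    rcases g with (k | k) | k | g | g <;> simp [circuitLabel]
    cases N.op g <;> simp [opLabel]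
  input_source j h := id
  aux_source j h := id
  const_source g c hg h := by
    rcases g with (k | k) | k | g | g <;> simp [circuitLabel] at hg
    simp only [circuitEdge]
    cases ho : N.op g <;> simp_all [opLabel, opPreds]
  output_indeg j := ⟨_, rfl, fun _ h => h⟩
  output_outdeg j h e := by
    cases h with
    | mem i => exact e
    | out k => cases e
    | comp g => rcases mem_opPreds e with ⟨i, hi⟩ | ⟨g, hg, hi⟩ <;> cases hi
    | copy g => cases e
  func_indeg g f hg := by
    obtain ⟨g', h', rfl, hh⟩ := N.circuitLabel_eq_func hg
    refine ⟨.copy h', ?_, fun y hy => ?_⟩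
    · simp [circuitEdge, hh, opPreds]
    · simpa [circuitEdge, hh, opPreds] using hy
  -- This is the purpose of the copies: a function gate feeds only its copy, and the copy, being an
  -- addition gate, has unrestricted fan-out.
  func_outdeg g f hg := by
    obtain ⟨g', h', rfl, hh⟩ := N.circuitLabel_eq_func hg
    refine ⟨.copy g', rfl, fun y hy => ?_⟩
    cases y with
    | mem i => exact hy.elim
    | out k => cases hy
    | comp g => rcases mem_opPreds hy with ⟨i, hi⟩ | ⟨g, hg, hi⟩ <;> cases hi
    | copy g => cases hy; rfl

theorem toCircuit_gatesIn : (N.toCircuit out).GatesIn B := fun g f hg => by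
  obtain ⟨g', h', rfl, hh⟩ := N.circuitLabel_eq_func hg
  exact N.func_mem _ _ _ hh

theorem toCircuit_size : (N.toCircuit out).size = n + ℓ + m + 2 * Fintype.card N.Gate :=
  NetGate.card_eq n ℓ m N.Gate

theorem toCircuit_depth_le {d : ℕ} (hd : ∀ g, N.rank g ≤ d) :
    (N.toCircuit out).depth ≤ 2 * d + 3 :=
  (N.toCircuit out).depth_le_of_rank (N.circuitRank d) (fun _ _ => N.circuitRank_lt out hd)
    (N.circuitRank_le hd)

theorem toCircuit_value_copy (x : Fin n → ℝ) (a : Fin ℓ → ℝ) (g : N.Gate) :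
    (N.toCircuit out).value x a (.copy g) = (N.toCircuit out).value x a (.comp g) := by
  rw [(N.toCircuit out).value_of_add (S := {.comp g}) rfl fun h => by
    simp [toCircuit, circuitEdge]]
  simp

/-- By induction on the rank, the equations of a valuation determine it, and the values in the
circuit satisfy the same equations. -/
theorem toCircuit_value_comp {x : Fin n → ℝ} {a : Fin ℓ → ℝ} {v : N.Gate → ℝ}
    (hv : N.IsValuation (Sum.elim x a) v) (g : N.Gate) :
    (N.toCircuit out).value x a (.comp g) = v g := by
  induction hr : N.rank g using Nat.strong_induction_on generalizing g with
  | _ r ih =>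
  have ih' : ∀ h ∈ (N.op g).preds, (N.toCircuit out).value x a (.copy h) = v h := fun h hh => by
    rw [toCircuit_value_copy]
    exact ih _ (hr ▸ N.rank_lt g h hh) h rfl
  have hl : (N.toCircuit out).label (.comp g) = opLabel (N.op g) := rfl
  have he : ∀ h, (N.toCircuit out).edge h (.comp g) ↔ h ∈ opPreds (N.op g) := fun h => Iff.rfl
  rw [hv g]
  cases ho : N.op g with
  | input i =>
    rw [ho] at hl he
    rw [(N.toCircuit out).value_of_add (S := {.mem i}) hl fun h => by rw [he]; simp [opPreds]]
    rw [Finset.sum_singleton]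
    cases i with
    | inl j => exact (N.toCircuit out).value_of_input rfl
    | inr j => exact (N.toCircuit out).value_of_aux rfl
  | const c =>
    rw [ho] at hl
    exact (N.toCircuit out).value_of_const hl
  | add S =>
    rw [ho] at hl he ih'
    rw [(N.toCircuit out).value_of_add (S := S.map ⟨.copy, fun _ _ h => by cases h; rfl⟩) hl
      fun h => by rw [he]; simp only [Finset.mem_map, opPreds, eq_comm]; rfl, Finset.sum_map]
    exact Finset.sum_congr rfl ih'
  | mul S =>
    rw [ho] at hl he ih'
    rw [(N.toCircuit out).value_of_mul (S := S.map ⟨.copy, fun _ _ h => by cases h; rfl⟩) hl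
      fun h => by rw [he]; simp only [Finset.mem_map, opPreds, eq_comm]; rfl, Finset.prod_map]
    exact Finset.prod_congr rfl ih'
  | func f h =>
    rw [ho] at hl he ih'
    rw [(N.toCircuit out).value_of_func (h := .copy h) hl fun h => by rw [he]; simp [opPreds],
      ih' h (by simp [NetOp.preds])]
    rfl

theorem toCircuit_eval (x : Fin n → ℝ) (a : Fin ℓ → ℝ) (j : Fin m) :
    (N.toCircuit out).eval x a j = (N.toCircuit out).value x a (.copy (out j)) :=
  (N.toCircuit out).value_of_output (j := j) rfl fun _ => Iff.rfl

end Net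

/-- Finitely many functions computed by nets are computed by the gates of a circuit. -/
theorem exists_circuit {B : Set (ℝ → ℝ)} {n ℓ m : ℕ} {O : Type} [Fintype O]
    {f : O → (Fin n ⊕ Fin ℓ → ℝ) → ℝ} {s d : ℕ} (hf : ∀ o, NetComputable B (f o) s d)
    (out : Fin m → O) :
    ∃ (C : ExtCircuit n ℓ m) (gate : O → C.Gate),
      (∀ o j, gate o ≠ C.outGate j) ∧
      (∀ x a o, C.value x a (gate o) = f o (Sum.elim x a)) ∧
      (∀ x a j, C.eval x a j = f (out j) (Sum.elim x a)) ∧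
      C.GatesIn B ∧ C.size ≤ n + ℓ + m + 2 * (Fintype.card O * s) ∧ C.depth ≤ 2 * d + 3 := by
  obtain ⟨N, q, h1, h2, h3⟩ := NetComputable.exists_net hf
  have hv : ∀ x a o, (N.toCircuit (q ∘ out)).value x a (.copy (q o)) = f o (Sum.elim x a) := by
    intro x a o
    obtain ⟨v, hv, hvo⟩ := h1 (Sum.elim x a)
    rw [N.toCircuit_value_copy, N.toCircuit_value_comp _ hv, hvo]
  -- The functions are read off at copies, which are never output gates and hence may be sources of
  -- recurrent edges.
  refine ⟨N.toCircuit (q ∘ out), fun o => .copy (q o), fun o j h => (by cases h), hv, ?_,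
    N.toCircuit_gatesIn _, ?_, N.toCircuit_depth_le _ h3⟩
  · intro x a j
    rw [N.toCircuit_eval]
    exact hv x a (out j)
  · rw [N.toCircuit_size]
    omega

/-! ### Polynomial bounds -/

/-- The quantity `c` is polynomially bounded in the weight `w`. -/
def PolyBdd {P : Type} (w c : P → ℕ) : Prop := ∃ a k, ∀ p, c p ≤ a * (w p + 1) ^ k

theorem poly_mono {a a' k k' x : ℕ} (ha : a ≤ a') (hk : k ≤ k') :
    a * (x + 1) ^ k ≤ a' * (x + 1) ^ k' :=
  Nat.mul_le_mul ha (Nat.pow_le_pow_right (Nat.succ_pos x) hk)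

namespace PolyBdd

variable {P : Type} {w c c' : P → ℕ}

theorem mono (h : PolyBdd w c') (hc : ∀ p, c p ≤ c' p) : PolyBdd w c := by
  obtain ⟨a, k, h⟩ := h
  exact ⟨a, k, fun p => (hc p).trans (h p)⟩

theorem reindex {P' : Type} (φ : P' → P) (h : PolyBdd w c) :
    PolyBdd (fun q => w (φ q)) (fun q => c (φ q)) := by
  obtain ⟨a, k, h⟩ := h
  exact ⟨a, k, fun q => h (φ q)⟩

theorem const (a : ℕ) : PolyBdd w fun _ => a := ⟨a, 0, fun p => by simp⟩

theorem self : PolyBdd w w := ⟨1, 1, fun p => by simp⟩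

theorem add (h : PolyBdd w c) (h' : PolyBdd w c') : PolyBdd w fun p => c p + c' p := by
  obtain ⟨a, k, h⟩ := h
  obtain ⟨a', k', h'⟩ := h'
  refine ⟨a + a', k + k', fun p => ?_⟩
  rw [add_mul]
  exact Nat.add_le_add ((h p).trans (poly_mono le_rfl (by omega)))
    ((h' p).trans (poly_mono le_rfl (by omega)))

theorem mul (h : PolyBdd w c) (h' : PolyBdd w c') : PolyBdd w fun p => c p * c' p := by
  obtain ⟨a, k, h⟩ := h
  obtain ⟨a', k', h'⟩ := h'
  refine ⟨a * a', k + k', fun p => ?_⟩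
  rw [pow_add, mul_mul_mul_comm]
  exact Nat.mul_le_mul (h p) (h' p)

/-- Polynomials are closed under composition. -/
theorem trans {P' : Type} {w' : P' → ℕ} {φ : P' → P} (h : PolyBdd w c)
    (h' : PolyBdd w' fun q => w (φ q)) : PolyBdd w' fun q => c (φ q) := by
  obtain ⟨a, k, h⟩ := h
  obtain ⟨a', k', h'⟩ := h'
  refine ⟨a * (a' + 1) ^ k, k' * k, fun q => (h (φ q)).trans ?_⟩
  rw [mul_assoc, pow_mul, ← mul_pow]
  refine Nat.mul_le_mul_left a (Nat.pow_le_pow_left ?_ k)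
  rw [add_mul, one_mul]
  exact Nat.add_le_add (h' q) (Nat.one_le_pow _ _ (Nat.succ_pos _))

theorem sigma {J : P → Type} [∀ p, Fintype (J p)] {b : (Σ p, J p) → ℕ}
    (hJ : PolyBdd w fun p => Fintype.card (J p))
    (hb : PolyBdd (fun q : Σ p, J p => w q.1) b) : PolyBdd w fun p => ∑ j, b ⟨p, j⟩ := by
  obtain ⟨a, k, hb⟩ := hb
  refine (hJ.mul (c' := fun p => a * (w p + 1) ^ k) ⟨a, k, fun p => le_rfl⟩).mono fun p => ?_
  refine (Finset.sum_le_sum fun j _ => hb ⟨p, j⟩).trans ?_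
  simp

/-- Finitely many polynomial bounds hold uniformly. -/
theorem finite {ι : Type} [Fintype ι] {P : ι → Type} {w c : ∀ i, P i → ℕ}
    (h : ∀ i, PolyBdd (w i) (c i)) :
    PolyBdd (fun q : Σ i, P i => w q.1 q.2) (fun q => c q.1 q.2) := by
  choose a k h using h
  refine ⟨∑ i, a i, ∑ i, k i, fun q => (h q.1 q.2).trans (poly_mono ?_ ?_)⟩
  · exact Finset.single_le_sum (fun _ _ => Nat.zero_le _) (Finset.mem_univ q.1)
  · exact Finset.single_le_sum (fun _ _ => Nat.zero_le _) (Finset.mem_univ q.1)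

end PolyBdd

/-- The binary length of `n + 1`. -/
def binLen (n : ℕ) : ℕ := Nat.size (n + 1)

theorem binLen_le {n t : ℕ} : binLen n ≤ t ↔ n + 1 < 2 ^ t := Nat.size_le

theorem one_le_binLen (n : ℕ) : 1 ≤ binLen n := Nat.size_pos.2 (Nat.succ_pos n)

theorem lt_two_pow_binLen (n : ℕ) : n + 1 < 2 ^ binLen n := Nat.lt_size_self _

theorem binLen_mono {n n' : ℕ} (h : n ≤ n') : binLen n ≤ binLen n' :=
  Nat.size_le_size (Nat.succ_le_succ h)

/-- The logarithm of a polynomial is linear in the logarithm; this is what lets depth bounds survive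
a polynomial change of weight in `Feasible.reweight`. -/
theorem binLen_poly_le (a k n : ℕ) : binLen (a * (n + 1) ^ k) ≤ (binLen a + k) * binLen n := by
  have h1 : binLen (a * (n + 1) ^ k) ≤ binLen a + binLen n * k := by
    rw [binLen_le, pow_add, pow_mul]
    calc a * (n + 1) ^ k + 1 ≤ (a + 1) * (n + 1) ^ k := by
          rw [add_mul, one_mul]
          exact Nat.add_le_add_left (Nat.one_le_pow _ _ (Nat.succ_pos _)) _
      _ < 2 ^ binLen a * (2 ^ binLen n) ^ k :=
          Nat.mul_lt_mul_of_lt_of_le (lt_two_pow_binLen a)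
            (Nat.pow_le_pow_left (lt_two_pow_binLen n).le k) (by positivity)
  refine h1.trans ?_
  rw [add_mul, mul_comm k]
  exact Nat.add_le_add_right (Nat.le_mul_of_pos_right _ (one_le_binLen n)) _

/-! ### Uniformly feasible families of functions -/

/-- The functions `f p` are computed by nets of size polynomial in the weight `w p` and of depth
`O((log (w p))^e)`, uniformly in `p`. -/
def Feasible (B : Set (ℝ → ℝ)) (e : ℕ) {P : Type} (w : P → ℕ) {I : P → Type}
    (f : ∀ p, (I p → ℝ) → ℝ) : Prop :=
  ∃ a k b, ∀ p, NetComputable B (f p) (a * (w p + 1) ^ k) (b * binLen (w p) ^ e)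

namespace Feasible

variable {B : Set (ℝ → ℝ)} {e : ℕ} {P : Type} {w : P → ℕ} {I : P → Type}

theorem of_bound {f : ∀ p, (I p → ℝ) → ℝ} {s d : P → ℕ} (hs : PolyBdd w s)
    (hd : ∃ b, ∀ p, d p ≤ b * binLen (w p) ^ e) (h : ∀ p, NetComputable B (f p) (s p) (d p)) :
    Feasible B e w f := by
  obtain ⟨a, k, hs⟩ := hs
  obtain ⟨b, hd⟩ := hd
  exact ⟨a, k, b, fun p => (h p).mono (hs p) (hd p)⟩

/-- Since `binLen` is at least 1, its powers absorb constants for every exponent, including 0. -/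
theorem const_depth (b : ℕ) : ∃ b', ∀ p, b ≤ b' * binLen (w p) ^ e :=
  ⟨b, fun _ => Nat.le_mul_of_pos_right _ (Nat.pow_pos (one_le_binLen _))⟩

theorem reindex {P' : Type} {f : ∀ p, (I p → ℝ) → ℝ} (φ : P' → P) (h : Feasible B e w f) :
    Feasible B e (fun q => w (φ q)) (fun q => f (φ q)) := by
  obtain ⟨a, k, b, h⟩ := h
  exact ⟨a, k, b, fun q => h (φ q)⟩

/-- Changing the weight to one that is polynomially related. -/
theorem reweight {w' : P → ℕ} {f : ∀ p, (I p → ℝ) → ℝ} (h : Feasible B e w f)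
    (hw : PolyBdd w' w) : Feasible B e w' f := by
  obtain ⟨a, k, b, h⟩ := h
  have hw' := hw
  obtain ⟨a', k', hw'⟩ := hw'
  refine of_bound (s := fun p => a * (w p + 1) ^ k) (d := fun p => b * binLen (w p) ^ e)
    (PolyBdd.trans (φ := id) ⟨a, k, fun p => le_rfl⟩ hw) ⟨b * (binLen a' + k') ^ e, fun p => ?_⟩ h
  rw [mul_assoc, ← mul_pow]
  exact Nat.mul_le_mul_left b (Nat.pow_le_pow_left
    ((binLen_mono (hw' p)).trans (binLen_poly_le _ _ _)) e)

/-- Two feasible families that cover the index set. -/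
theorem glue {P₁ P₂ : Type} {f : ∀ p, (I p → ℝ) → ℝ} (φ : P₁ → P) (ψ : P₂ → P)
    (h₁ : Feasible B e (fun q => w (φ q)) fun q => f (φ q))
    (h₂ : Feasible B e (fun q => w (ψ q)) fun q => f (ψ q))
    (hc : ∀ p, (∃ q, φ q = p) ∨ ∃ q, ψ q = p) : Feasible B e w f := by
  obtain ⟨a, k, b, h₁⟩ := h₁
  obtain ⟨a', k', b', h₂⟩ := h₂
  refine ⟨a + a', k + k', b + b', fun p => ?_⟩
  rcases hc p with ⟨q, rfl⟩ | ⟨q, rfl⟩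
  · exact (h₁ q).mono (poly_mono (by omega) (by omega)) (Nat.mul_le_mul_right _ (by omega))
  · exact (h₂ q).mono (poly_mono (by omega) (by omega)) (Nat.mul_le_mul_right _ (by omega))

/-- Finitely many feasible families are uniformly feasible. -/
theorem finite {ι : Type} [Fintype ι] {P : ι → Type} {w : ∀ i, P i → ℕ} {I : ∀ i, P i → Type}
    {f : ∀ i p, (I i p → ℝ) → ℝ} (h : ∀ i, Feasible B e (w i) (f i)) :
    Feasible B e (fun q : Σ i, P i => w q.1 q.2) (fun q => f q.1 q.2) := by
  choose a k b h using h
  have key : ∀ (u : ι → ℕ) (i : ι), u i ≤ ∑ j, u j := fun u i =>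
    Finset.single_le_sum (fun _ _ => Nat.zero_le _) (Finset.mem_univ i)
  exact ⟨∑ i, a i, ∑ i, k i, ∑ i, b i, fun q => (h q.1 q.2).mono (poly_mono (key a _) (key k _))
    (Nat.mul_le_mul_right _ (key b _))⟩

/-- The coordinates of states form nested sum types; this lemma and `finCases` treat a family
indexed by coordinates block by block. -/
theorem sumCases {J K : P → Type} {f : ∀ q : Σ p, J p ⊕ K p, (I q.1 → ℝ) → ℝ}
    (h₁ : Feasible B e (fun q : Σ p, J p => w q.1) fun q => f ⟨q.1, .inl q.2⟩)
    (h₂ : Feasible B e (fun q : Σ p, K p => w q.1) fun q => f ⟨q.1, .inr q.2⟩) :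
    Feasible B e (fun q : Σ p, J p ⊕ K p => w q.1) f :=
  glue (fun q : Σ p, J p => ⟨q.1, .inl q.2⟩) (fun q : Σ p, K p => ⟨q.1, .inr q.2⟩) h₁ h₂ <| by
    rintro ⟨p, j | k⟩
    · exact .inl ⟨⟨p, j⟩, rfl⟩
    · exact .inr ⟨⟨p, k⟩, rfl⟩

theorem finCases {r : P → ℕ} {f : ∀ q : Σ p, Fin (r p + 1), (I q.1 → ℝ) → ℝ}
    (h₁ : Feasible B e w fun p => f ⟨p, 0⟩)
    (h₂ : Feasible B e (fun q : Σ p, Fin (r p) => w q.1) fun q => f ⟨q.1, q.2.succ⟩) :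
    Feasible B e (fun q : Σ p, Fin (r p + 1) => w q.1) f :=
  glue (fun p => ⟨p, 0⟩) (fun q : Σ p, Fin (r p) => ⟨q.1, q.2.succ⟩) h₁ h₂ <| by
    rintro ⟨p, j⟩
    cases j using Fin.cases with
    | zero => exact .inl ⟨p, rfl⟩
    | succ j => exact .inr ⟨⟨p, j⟩, rfl⟩

theorem var (i : ∀ p, I p) : Feasible B e w fun p (x : I p → ℝ) => x (i p) :=
  of_bound (PolyBdd.const 1) (const_depth 0) fun p => NetComputable.var (i p)

theorem const (c : P → ℝ) : Feasible B e w fun p (_ : I p → ℝ) => c p :=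
  of_bound (PolyBdd.const 1) (const_depth 0) fun p => NetComputable.const (c p)

/-- Sizes multiply by a polynomial and depths add up, so the depth bound is preserved as long as
substitutions are nested boundedly often. -/
theorem subst {M : P → Type} [∀ p, Fintype (M p)] {f : ∀ p, (M p → ℝ) → ℝ}
    {g : ∀ p, M p → (I p → ℝ) → ℝ} (hf : Feasible B e w f)
    (hg : Feasible B e (fun q : Σ p, M p => w q.1) fun q => g q.1 q.2)
    (hM : PolyBdd w fun p => Fintype.card (M p)) :
    Feasible B e w fun p x => f p fun m => g p m x := by
  obtain ⟨a, k, b, hf⟩ := hf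
  obtain ⟨a', k', b', hg⟩ := hg
  refine of_bound (d := fun p => b * binLen (w p) ^ e + b' * binLen (w p) ^ e + 1)
    (PolyBdd.add ⟨a, k, fun p => le_rfl⟩
    (hM.mul (c' := fun p => a' * (w p + 1) ^ k') ⟨a', k', fun p => le_rfl⟩))
    ⟨b + b' + 1, fun p => ?_⟩ fun p => (hf p).subst fun m => hg ⟨p, m⟩
  rw [add_mul, add_mul]
  refine Nat.add_le_add_left ?_ _
  rw [one_mul]
  exact Nat.pow_pos (one_le_binLen _)

theorem sum {J : P → Type} [∀ p, Fintype (J p)] {f : ∀ p, J p → (I p → ℝ) → ℝ}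
    (hf : Feasible B e (fun q : Σ p, J p => w q.1) fun q => f q.1 q.2)
    (hJ : PolyBdd w fun p => Fintype.card (J p)) :
    Feasible B e w fun p x => ∑ j, f p j x :=
  subst (f := fun p (y : J p → ℝ) => ∑ j, y j)
    (of_bound (hJ.add (PolyBdd.const 1)) (const_depth 1) fun _ => NetComputable.sum) hf hJ

theorem prod {J : P → Type} [∀ p, Fintype (J p)] {f : ∀ p, J p → (I p → ℝ) → ℝ}
    (hf : Feasible B e (fun q : Σ p, J p => w q.1) fun q => f q.1 q.2)
    (hJ : PolyBdd w fun p => Fintype.card (J p)) :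
    Feasible B e w fun p x => ∏ j, f p j x :=
  subst (f := fun p (y : J p → ℝ) => ∏ j, y j)
    (of_bound (hJ.add (PolyBdd.const 1)) (const_depth 1) fun _ => NetComputable.prod) hf hJ

theorem bool {f g : ∀ p, (I p → ℝ) → ℝ} (hf : Feasible B e w f) (hg : Feasible B e w g) :
    Feasible B e (fun q : Σ _ : P, Bool => w q.1) fun q => cond q.2 (f q.1) (g q.1) :=
  glue (fun p => ⟨p, true⟩) (fun p => ⟨p, false⟩) hf hg <| by
    rintro ⟨p, _ | _⟩
    · exact .inr ⟨p, rfl⟩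
    · exact .inl ⟨p, rfl⟩

theorem add {f g : ∀ p, (I p → ℝ) → ℝ} (hf : Feasible B e w f) (hg : Feasible B e w g) :
    Feasible B e w fun p x => f p x + g p x := by
  simpa using sum (f := fun p (t : Bool) => cond t (f p) (g p)) (bool hf hg) (PolyBdd.const 2)

theorem mul {f g : ∀ p, (I p → ℝ) → ℝ} (hf : Feasible B e w f) (hg : Feasible B e w g) :
    Feasible B e w fun p x => f p x * g p x := by
  simpa using prod (f := fun p (t : Bool) => cond t (f p) (g p)) (bool hf hg) (PolyBdd.const 2)

theorem sub {f g : ∀ p, (I p → ℝ) → ℝ} (hf : Feasible B e w f) (hg : Feasible B e w g) :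
    Feasible B e w fun p x => f p x - g p x := by
  simpa [sub_eq_add_neg] using hf.add ((const fun _ => -1).mul hg)

theorem func {σ : P → ℝ → ℝ} {f : ∀ p, (I p → ℝ) → ℝ} (hσ : ∀ p, σ p ∈ B)
    (hf : Feasible B e w f) : Feasible B e w fun p x => σ p (f p x) :=
  subst (M := fun _ => Unit) (f := fun p (y : Unit → ℝ) => σ p (y ()))
    (g := fun p _ => f p)
    (of_bound (PolyBdd.const 2) (const_depth 1) fun p => NetComputable.func (hσ p))
    (hf.reindex fun q : Σ _ : P, Unit => q.1) (PolyBdd.const 1)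

/-- `(1 - c) * f + c * g`: the value of `f` if `c = 0` and that of `g` if `c = 1`. -/
theorem select {c f g : ∀ p, (I p → ℝ) → ℝ} (hc : Feasible B e w c) (hf : Feasible B e w f)
    (hg : Feasible B e w g) :
    Feasible B e w fun p x => (1 - c p x) * f p x + c p x * g p x :=
  (((const fun _ => 1).sub hc).mul hf).add (hc.mul hg)

end Feasible

/-! ### Circuit families and feasible families -/

theorem log_le_binLen (n : ℕ) : Real.log n ≤ binLen n := by
  rcases Nat.eq_zero_or_pos n with rfl | hn
  · simp
  have h1 : (n : ℝ) ≤ 2 ^ binLen n := by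
    have := lt_two_pow_binLen n
    exact_mod_cast (show n ≤ 2 ^ binLen n by omega)
  calc Real.log n ≤ Real.log (2 ^ binLen n) := Real.log_le_log (by exact_mod_cast hn) h1
    _ = binLen n * Real.log 2 := by rw [Real.log_pow]
    _ ≤ binLen n * 1 := by
        have := Real.log_two_lt_d9
        gcongr
        linarith
    _ = binLen n := mul_one _

/-- Since `2 ^ (binLen n - 1) ≤ n + 1 ≤ n ^ 2` for `n ≥ 2`, one gets `binLen n * log 2 ≤ 3 * log n`,
and `log 2 > 1 / 2`. The bound fails at `n = 1`, where the logarithm vanishes. -/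
theorem binLen_le_log {n : ℕ} (hn : 2 ≤ n) : (binLen n : ℝ) ≤ 6 * Real.log n := by
  have hn' : (2 : ℝ) ≤ n := by exact_mod_cast hn
  have h2 := Real.log_two_gt_d9
  have h3 : Real.log 2 ≤ Real.log n := Real.log_le_log (by norm_num) hn'
  have h4 : 2 ^ (binLen n - 1) ≤ n + 1 := by
    rw [← Nat.lt_size]
    exact Nat.sub_lt (one_le_binLen n) one_pos
  have h5 : ((binLen n - 1 : ℕ) : ℝ) * Real.log 2 ≤ 2 * Real.log n := by
    rw [← Real.log_pow, ← Nat.cast_two (R := ℝ), ← Real.log_pow]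
    refine Real.log_le_log (by positivity) ?_
    have h6 : n + 1 ≤ n ^ 2 := by nlinarith
    exact_mod_cast h4.trans h6
  rw [Nat.cast_sub (one_le_binLen n), Nat.cast_one] at h5
  have h7 : (1 : ℝ) ≤ binLen n := by exact_mod_cast one_le_binLen n
  nlinarith

/-- A bound that holds eventually holds everywhere with another constant. -/
theorem exists_bound_of_eventually {s t : ℕ → ℕ} {c : ℝ} (ht : ∀ n, 1 ≤ t n)
    (h : ∀ᶠ n in Filter.atTop, (s n : ℝ) ≤ c * t n) : ∃ a, ∀ n, s n ≤ a * t n := by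
  obtain ⟨N, hN⟩ := Filter.eventually_atTop.1 h
  -- The added sum dominates the finitely many values to which the eventual bound does not apply.
  refine ⟨⌈c⌉₊ + ∑ n ∈ Finset.range N, s n, fun n => ?_⟩
  rcases lt_or_ge n N with hn | hn
  · have h1 : s n ≤ ∑ n ∈ Finset.range N, s n :=
      Finset.single_le_sum (fun _ _ => Nat.zero_le _) (Finset.mem_range.2 hn)
    exact (h1.trans (Nat.le_add_left _ _)).trans (Nat.le_mul_of_pos_right _ (ht n))
  · have h1 : (s n : ℝ) ≤ (⌈c⌉₊ * t n : ℕ) := by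
      push_cast
      exact (hN n hn).trans (mul_le_mul_of_nonneg_right (Nat.le_ceil c) (Nat.cast_nonneg _))
    exact (Nat.cast_le.1 h1).trans (Nat.mul_le_mul_right _ (Nat.le_add_right _ _))

namespace CircuitClass

variable {F : CircuitClass} {ℓ m : ℕ → ℕ} {C : ∀ n, ExtCircuit n (ℓ n) (m n)}

theorem IsFamily.polyBdd_size (h : F.IsFamily C) : PolyBdd (fun n : ℕ => n) fun n => (C n).size := by
  obtain ⟨k, hk⟩ := h.2.1
  obtain ⟨c, hc⟩ := hk.bound
  obtain ⟨a, ha⟩ := exists_bound_of_eventually (s := fun n => (C n).size)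
    (t := fun n => (n + 1) ^ k) (c := |c|) (fun n => Nat.one_le_pow _ _ (Nat.succ_pos n)) <| by
      filter_upwards [hc] with n hn
      rw [Real.norm_natCast, norm_pow, Real.norm_natCast] at hn
      refine hn.trans (mul_le_mul (le_abs_self c) ?_ (by positivity) (abs_nonneg c))
      push_cast
      gcongr
      linarith
  exact ⟨a, k, ha⟩

theorem IsFamily.exists_depth_le (h : F.IsFamily C) :
    ∃ b, ∀ n, (C n).depth ≤ b * binLen n ^ F.exponent := by
  obtain ⟨c, hc⟩ := h.2.2.bound
  refine exists_bound_of_eventually (c := |c|) (fun n => Nat.pow_pos (one_le_binLen n)) ?_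
  filter_upwards [hc] with n hn
  rw [Real.norm_natCast, norm_pow, Real.norm_of_nonneg (Real.log_natCast_nonneg n)] at hn
  refine hn.trans (mul_le_mul (le_abs_self c) ?_ (pow_nonneg (Real.log_natCast_nonneg n) _)
    (abs_nonneg c))
  push_cast
  exact pow_le_pow_left₀ (Real.log_natCast_nonneg n) (log_le_binLen n) _

theorem isFamily_of_bounds (hC : ∀ n, (C n).GatesIn F.gates)
    (hs : PolyBdd (fun n : ℕ => n) fun n => (C n).size)
    (hd : ∃ b, ∀ n, (C n).depth ≤ b * binLen n ^ F.exponent) : F.IsFamily C := by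
  obtain ⟨a, k, hs⟩ := hs
  obtain ⟨b, hd⟩ := hd
  refine ⟨hC, ⟨k, ?_⟩, ?_⟩
  · refine Asymptotics.IsBigO.of_bound (a * 2 ^ k) ?_
    filter_upwards [Filter.eventually_ge_atTop 1] with n hn
    rw [Real.norm_natCast, norm_pow, Real.norm_natCast, mul_assoc, ← mul_pow]
    have h1 : (((C n).size : ℕ) : ℝ) ≤ (a * (n + 1) ^ k : ℕ) := by exact_mod_cast hs n
    refine h1.trans ?_
    push_cast
    have hn' : (1 : ℝ) ≤ n := by exact_mod_cast hn
    gcongr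
    linarith
  · refine Asymptotics.IsBigO.of_bound (b * 6 ^ F.exponent) ?_
    filter_upwards [Filter.eventually_ge_atTop 2] with n hn
    rw [Real.norm_natCast, norm_pow, Real.norm_of_nonneg (Real.log_natCast_nonneg n), mul_assoc,
      ← mul_pow]
    have h1 : (((C n).depth : ℕ) : ℝ) ≤ (b * binLen n ^ F.exponent : ℕ) := by exact_mod_cast hd n
    refine h1.trans ?_
    push_cast
    gcongr
    exact binLen_le_log hn

/-- All gates are included, not only the outputs, because recurrent edges start at inner gates and
halting gates may be any gates. -/
theorem IsFamily.feasible_value {B : Set (ℝ → ℝ)} (hB : F.gates ⊆ B) (h : F.IsFamily C) :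
    Feasible B F.exponent (fun q : Σ n, (C n).Gate => q.1)
      (I := fun q => Fin q.1 ⊕ Fin (ℓ q.1))
      fun q s => (C q.1).value (s ∘ Sum.inl) (s ∘ Sum.inr) q.2 := by
  obtain ⟨b, hb⟩ := h.exists_depth_le
  exact Feasible.of_bound (h.polyBdd_size.reindex Sigma.fst) ⟨b, fun q => hb q.1⟩
    fun q => (C q.1).netComputable_value (fun g f hg => hB (h.1 q.1 g f hg)) q.2

end CircuitClass

/-- A feasible family of functions is computed by a family of arithmetic circuits. -/
theorem exists_isFamily_of_feasible {F : CircuitClass} {f : ∀ n : ℕ, (Fin n → ℝ) → ℝ}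
    (hf : Feasible F.gates F.exponent (fun n : ℕ => n) f) :
    ∃ D : ∀ n, Circuit n 1, F.IsFamily D ∧ ∀ n x, (D n).eval x Fin.elim0 0 = f n x := by
  have hf' : Feasible F.gates F.exponent (fun n : ℕ => n) (I := fun n => Fin n ⊕ Fin 0)
      fun n x => f n fun j => x (.inl j) :=
    hf.subst
      (Feasible.var (I := fun q : Σ n : ℕ, Fin n => Fin q.1 ⊕ Fin 0) fun q => Sum.inl q.2)
      (by simpa using PolyBdd.self)
  obtain ⟨a, k, b, h⟩ := hf'
  choose D gate _ _ h3 h4 h5 h6 using fun n =>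
    exists_circuit (O := Unit) (m := 1) (fun _ => h n) fun _ => ()
  refine ⟨D, CircuitClass.isFamily_of_bounds h4 ?_ ⟨2 * b + 3, fun n => (h6 n).trans ?_⟩,
    fun n x => h3 n x Fin.elim0 0⟩
  · refine PolyBdd.mono ?_ h5
    refine ((PolyBdd.self.add (PolyBdd.const 0)).add (PolyBdd.const 1)).add
      ((PolyBdd.const 2).mul ((PolyBdd.const _).mul ⟨a, k, fun n => le_rfl⟩))
  · have h7 : 1 ≤ binLen n ^ F.exponent := Nat.pow_pos (one_le_binLen n)
    rw [add_mul, mul_assoc]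
    dsimp only
    omega

/-! ### Recurrent circuits as dynamical systems on real vectors -/

namespace RecCircuit

variable {n m : ℕ} (R : RecCircuit n m)

/-- The coordinates of a state of a recurrent circuit: the iteration number and the memory. -/
abbrev Coord : Type := Unit ⊕ (Fin n ⊕ Fin R.numAux)

/-- The value of a gate in a state. -/
def gateVal (s : R.Coord → ℝ) (g : R.circ.Gate) : ℝ :=
  R.circ.value (fun j => s (.inr (.inl j))) (fun j => s (.inr (.inr j))) g

/-- The state in the first iteration on input `x`. -/
def initState (x : Fin n → ℝ) : R.Coord → ℝ :=
  Sum.elim (fun _ => 1) (Sum.elim x R.init)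

/-- The state in the next iteration. -/
def stepState (s : R.Coord → ℝ) : R.Coord → ℝ :=
  Sum.elim (fun _ => s (.inl ()) + 1)
    (Sum.elim (fun j => R.gateVal s (R.recIn j)) (fun j => R.gateVal s (R.recAux j)))

/-- The value of the halting function in a state, computed by the circuit `D`. -/
def haltFlag (D : Circuit (R.numHalt + 1) 1) (s : R.Coord → ℝ) : ℝ :=
  D.eval (Fin.cons (s (.inl ())) fun j => R.gateVal s (R.haltGate j)) Fin.elim0 0

/-- The value of the first output gate in a state. -/
def firstOut (s : R.Coord → ℝ) : ℝ :=
  if h : 0 < m then R.gateVal s (R.circ.outGate ⟨0, h⟩) else 0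

/-- The state in the next iteration; a halting state is kept. -/
def frozenStep (D : Circuit (R.numHalt + 1) 1) (s : R.Coord → ℝ) : R.Coord → ℝ :=
  fun c => (1 - R.haltFlag D s) * R.stepState s c + R.haltFlag D s * s c

end RecCircuit

/-! ### The simulation of a network -/

/-- The circuits and activation functions of a network whose layers have period `d`. -/
structure NetworkData (d : ℕ) where
  fam : ZMod d → RecFamily
  haltCirc : ZMod d → ∀ k, Circuit k 1
  act : ZMod d → ℝ → ℝ
  outerHalt : ∀ k, Circuit k 1

/-- The indicator function of `z = j`, for integers `z`. -/
def eqInd (z : ℝ) (j : ℕ) : ℝ := signFn (z - (j - 1 / 2)) * signFn (j + 1 / 2 - z)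

namespace NetworkData

variable {d : ℕ} (S : NetworkData d)

/-- The recurrent circuit for the layers of residue `c` and vertices of degree `m`. -/
abbrev inst (c : ZMod d) (m : ℕ) : RecCircuit (m + 1) ((S.fam c).numOut (m + 1)) :=
  (S.fam c).circuit (m + 1)

/-- The circuit for the halting function of `S.inst c m`. -/
abbrev instHalt (c : ZMod d) (m : ℕ) : Circuit ((S.inst c m).numHalt + 1) 1 :=
  S.haltCirc c ((S.inst c m).numHalt + 1)

variable (n : ℕ)

/-- The instances run in parallel on graphs of order `n`: one for each vertex, residue and
degree. -/
abbrev Inst (d n : ℕ) : Type := Fin n × ZMod d × Fin n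

/-- The coordinates of the encoding of a graph of order `n`. -/
abbrev InCoord (n : ℕ) : Type := (Fin n × Fin n) ⊕ Fin n

/-- The auxiliary coordinates of the simulation: the number of the current layer, a flag for its
first iteration, the indicator of the residue of its number, and the states of the instances. -/
abbrev AuxCoord : Type :=
  (Unit ⊕ Unit) ⊕ (ZMod d ⊕ Σ q : Inst d n, (S.inst q.2.1 q.2.2).Coord)

/-- The coordinates of the states of the simulation. -/
abbrev StateCoord : Type := InCoord n ⊕ S.AuxCoord n

variable {n} [NeZero d] (s : S.StateCoord n → ℝ)

/-- The adjacency matrix. -/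
def adj (u v : Fin n) : ℝ := s (.inl (.inl (u, v)))

/-- The features before the current layer. -/
def feat (v : Fin n) : ℝ := s (.inl (.inr v))

/-- The number of the current layer. -/
def cnt : ℝ := s (.inr (.inl (.inl ())))

/-- The flag for the first iteration in the current layer. -/
def fresh : ℝ := s (.inr (.inl (.inr ())))

/-- The indicator of the residue of the number of the current layer. -/
def phase (c : ZMod d) : ℝ := s (.inr (.inr (.inl c)))

/-- The stored state of an instance. -/
def mem (q : Inst d n) (x : (S.inst q.2.1 q.2.2).Coord) : ℝ := s (.inr (.inr (.inr ⟨q, x⟩)))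

/-- The degree of a vertex. -/
def deg (w : Fin n) : ℝ := ∑ u, S.adj s w u

/-- The indicator of the instances that belong to the current layer and the graph. -/
def sel (q : Inst d n) : ℝ := S.phase s q.2.1 * eqInd (S.deg s q.1) q.2.2

/-- The number of neighbours of `w` before `u`. -/
def before (w u : Fin n) : ℝ := ∑ u', (if u' < u then 1 else 0) * S.adj s w u'

/-- The feature of the `j`th neighbour of `w`. -/
def nbr (w : Fin n) (j : ℕ) : ℝ := ∑ u, S.feat s u * (S.adj s w u * eqInd (S.before s w u) j)

/-- The initial state of an instance in the current layer. -/
def loaded (q : Inst d n) : (S.inst q.2.1 q.2.2).Coord → ℝ :=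
  (S.inst q.2.1 q.2.2).initState (Fin.cons (S.feat s q.1) fun j => S.nbr s q.1 j)

/-- The current state of an instance. -/
def cur (q : Inst d n) (x : (S.inst q.2.1 q.2.2).Coord) : ℝ :=
  (1 - S.fresh s) * S.mem s q x + S.fresh s * S.loaded s q x

/-- The halting flag of an instance. -/
def flag (q : Inst d n) : ℝ :=
  (S.inst q.2.1 q.2.2).haltFlag (S.instHalt q.2.1 q.2.2) (S.cur s q)

/-- The indicator of the event that the instances of all vertices have halted. -/
def allHalted : ℝ := ∏ w, ∑ p : ZMod d × Fin n, S.sel s (w, p) * S.flag s (w, p)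

/-- The features after the current layer. -/
def newFeat (w : Fin n) : ℝ :=
  ∑ p : ZMod d × Fin n, S.sel s (w, p) *
    S.act p.1 ((S.inst p.1 p.2).firstOut (S.cur s (w, p)))

/-- The value of the halting gate. -/
def haltVal : ℝ :=
  S.allHalted s * (S.outerHalt (n + 1)).eval (Fin.cons (S.cnt s) (S.newFeat s)) Fin.elim0 0

/-- The state in the next iteration. -/
def next : S.StateCoord n → ℝ :=
  Sum.elim
    (Sum.elim (fun p => S.adj s p.1 p.2)
      (fun v => (1 - S.allHalted s) * S.feat s v + S.allHalted s * S.newFeat s v))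
    (Sum.elim
      (Sum.elim (fun _ => S.cnt s + S.allHalted s) (fun _ => S.allHalted s))
      (Sum.elim
        (fun c => (1 - S.allHalted s) * S.phase s c + S.allHalted s * S.phase s (c - 1))
        (fun p => (S.inst p.1.2.1 p.1.2.2).frozenStep (S.instHalt p.1.2.1 p.1.2.2)
          (S.cur s p.1) p.2)))

/-- The encoding of the resulting graph. -/
def result : InCoord n → ℝ := Sum.elim (fun p => S.adj s p.1 p.2) (S.newFeat s)

/-! ### Feasibility of the simulation -/

/-- The circuits of the network data form families of the classes required for `F` and `A`. -/
structure IsOfClass (F : CircuitClass) (A : Set (ℝ → ℝ)) : Prop where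
  fam : ∀ c, F.IsFamily fun n => ((S.fam c).circuit n).circ
  haltCirc : ∀ c, F.withSign.IsFamily (S.haltCirc c)
  act : ∀ c, S.act c ∈ A
  outerHalt : F.withSign.IsFamily S.outerHalt

variable {S} {F : CircuitClass} {A : Set (ℝ → ℝ)}

theorem IsOfClass.polyBdd_size (h : S.IsOfClass F A) :
    PolyBdd (fun q : Σ _ : ZMod d, ℕ => q.2) fun q => (S.inst q.1 q.2).circ.size :=
  (PolyBdd.finite fun c => (h.fam c).polyBdd_size).trans
    (φ := fun q : Σ _ : ZMod d, ℕ => ⟨q.1, q.2 + 1⟩) (PolyBdd.self.add (PolyBdd.const 1))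

end NetworkData

namespace RecCircuit

variable {n m : ℕ} (R : RecCircuit n m)

theorem numAux_le : R.numAux ≤ R.circ.size := by
  simpa [ExtCircuit.size] using Fintype.card_le_of_injective _ R.circ.auxGate_injective

theorem numHalt_le : R.numHalt ≤ R.circ.size := by
  simpa [ExtCircuit.size] using Fintype.card_le_of_injective _ R.haltGate.injective

end RecCircuit

namespace CircuitClass

variable (F : CircuitClass) (A : Set (ℝ → ℝ))

theorem gates_subset_adjoin : F.gates ⊆ (F.withSign.adjoin A).gates := fun _ h => .inl (.inl h)

theorem withSign_gates_subset_adjoin : F.withSign.gates ⊆ (F.withSign.adjoin A).gates :=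
  fun _ h => .inl h

theorem signFn_mem_withSign : signFn ∈ F.withSign.gates := .inr rfl

end CircuitClass

/-! ### Feasibility of the maps of a single instance -/

namespace NetworkData

variable {d : ℕ} [NeZero d] {S : NetworkData d} {F : CircuitClass} {A : Set (ℝ → ℝ)}

/-- Uniform feasibility with the gates and the depth of the class `F_s[A]`. -/
abbrev Feas (F : CircuitClass) (A : Set (ℝ → ℝ)) {P : Type} (w : P → ℕ) {I : P → Type}
    (f : ∀ p, (I p → ℝ) → ℝ) : Prop :=
  Feasible (F.withSign.adjoin A).gates F.exponent w f

theorem IsOfClass.polyBdd_coord (h : S.IsOfClass F A) :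
    PolyBdd (fun q : Σ _ : ZMod d, ℕ => q.2) fun q => Fintype.card (S.inst q.1 q.2).Coord := by
  refine PolyBdd.mono ((PolyBdd.const 1).add
    ((PolyBdd.self.add (PolyBdd.const 1)).add h.polyBdd_size)) fun q => ?_
  have := (S.inst q.1 q.2).numAux_le
  simp only [Fintype.card_sum, Fintype.card_fin, Fintype.card_unit]
  omega

theorem IsOfClass.gateVal (h : S.IsOfClass F A) :
    Feas F A (fun q : Σ p : (Σ _ : ZMod d, ℕ), (S.inst p.1 p.2).circ.Gate => q.1.2)
      (I := fun q => (S.inst q.1.1 q.1.2).Coord)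
      fun q s => (S.inst q.1.1 q.1.2).gateVal s q.2 := by
  have h1 := Feasible.finite fun c => (h.fam c).feasible_value (F.gates_subset_adjoin A)
  have h2 := h1.reindex fun q : Σ p : (Σ _ : ZMod d, ℕ), (S.inst p.1 p.2).circ.Gate =>
    ⟨q.1.1, ⟨q.1.2 + 1, q.2⟩⟩
  have h3 := h2.reweight (w' := fun q => q.1.2) (PolyBdd.self.add (PolyBdd.const 1))
  refine Feasible.subst (P := Σ p : (Σ _ : ZMod d, ℕ), (S.inst p.1 p.2).circ.Gate)
    (I := fun q => (S.inst q.1.1 q.1.2).Coord)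
    (M := fun q => Fin (q.1.2 + 1) ⊕ Fin (S.inst q.1.1 q.1.2).numAux)
    (g := fun q j s => s (.inr j)) h3 (Feasible.var _) ?_
  refine (h.polyBdd_coord.reindex fun q : Σ p : (Σ _ : ZMod d, ℕ),
    (S.inst p.1 p.2).circ.Gate => q.1).mono fun q => ?_
  simp

/-- The halting circuit is indexed by the number of halting gates rather than by the degree. Halting
gates are distinct gates of the underlying circuit, so their number is polynomial in the degree and
the weight can be changed. -/
theorem IsOfClass.haltFlag (h : S.IsOfClass F A) :
    Feas F A (fun q : Σ _ : ZMod d, ℕ => q.2) (I := fun q => (S.inst q.1 q.2).Coord)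
      fun q s => (S.inst q.1 q.2).haltFlag (S.instHalt q.1 q.2) s := by
  have h1 := Feasible.finite fun c =>
    (h.haltCirc c).feasible_value (F.withSign_gates_subset_adjoin A)
  have hn : PolyBdd (fun q : Σ _ : ZMod d, ℕ => q.2) fun q => (S.inst q.1 q.2).numHalt + 1 :=
    (h.polyBdd_size.mono fun q => (S.inst q.1 q.2).numHalt_le).add (PolyBdd.const 1)
  have h2 := (h1.reindex fun q : Σ _ : ZMod d, ℕ =>
    ⟨q.1, ⟨(S.inst q.1 q.2).numHalt + 1, (S.instHalt q.1 q.2).outGate 0⟩⟩).reweight hn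
  refine Feasible.subst (P := Σ _ : ZMod d, ℕ) (I := fun q => (S.inst q.1 q.2).Coord)
    (M := fun q => Fin ((S.inst q.1 q.2).numHalt + 1) ⊕ Fin 0)
    (g := fun q => Sum.elim (fun j s => (Fin.cons (s (.inl ()))
      fun j => (S.inst q.1 q.2).gateVal s ((S.inst q.1 q.2).haltGate j) : Fin _ → ℝ) j)
      fun j _ => Fin.elim0 j) h2 ?_ ?_
  · refine Feasible.sumCases (w := fun p : Σ _ : ZMod d, ℕ => p.2)
      (I := fun p => (S.inst p.1 p.2).Coord)
      (Feasible.finCases (w := fun p : Σ _ : ZMod d, ℕ => p.2)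
        (I := fun p => (S.inst p.1 p.2).Coord) ?_ ?_) ?_
    · exact Feasible.var (I := fun q : Σ _ : ZMod d, ℕ => (S.inst q.1 q.2).Coord) fun _ => .inl ()
    · exact h.gateVal.reindex fun q : Σ p : (Σ _ : ZMod d, ℕ), Fin (S.inst p.1 p.2).numHalt =>
        ⟨q.1, (S.inst q.1.1 q.1.2).haltGate q.2⟩
    · exact Feasible.const _
  · simpa using hn

theorem IsOfClass.firstOut (h : S.IsOfClass F A) :
    Feas F A (fun q : Σ _ : ZMod d, ℕ => q.2) (I := fun q => (S.inst q.1 q.2).Coord)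
      fun q s => (S.inst q.1 q.2).firstOut s := by
  refine Feasible.glue
    (P₁ := {q : Σ _ : ZMod d, ℕ // 0 < (S.fam q.1).numOut (q.2 + 1)})
    (P₂ := {q : Σ _ : ZMod d, ℕ // ¬ 0 < (S.fam q.1).numOut (q.2 + 1)})
    Subtype.val Subtype.val ?_ ?_ fun p => ?_
  · convert h.gateVal.reindex
      fun q : {q : Σ _ : ZMod d, ℕ // 0 < (S.fam q.1).numOut (q.2 + 1)} =>
        ⟨q.1, (S.inst q.1.1 q.1.2).circ.outGate ⟨0, q.2⟩⟩ using 3 with q s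
    simp [RecCircuit.firstOut, q.2]
  · convert Feasible.const (fun _ => 0) using 3 with q s
    simp [RecCircuit.firstOut, q.2]
  · by_cases hp : 0 < (S.fam p.1).numOut (p.2 + 1)
    · exact .inl ⟨⟨p, hp⟩, rfl⟩
    · exact .inr ⟨⟨p, hp⟩, rfl⟩

theorem IsOfClass.frozenStep (h : S.IsOfClass F A) :
    Feas F A (fun q : Σ p : (Σ _ : ZMod d, ℕ), (S.inst p.1 p.2).Coord => q.1.2)
      (I := fun q => (S.inst q.1.1 q.1.2).Coord)
      fun q s => (S.inst q.1.1 q.1.2).frozenStep (S.instHalt q.1.1 q.1.2) s q.2 := by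
  refine Feasible.select (h.haltFlag.reindex _) ?_ (Feasible.var _)
  refine Feasible.sumCases (w := fun p : Σ _ : ZMod d, ℕ => p.2)
    (I := fun p => (S.inst p.1 p.2).Coord) ?_
    (Feasible.sumCases (w := fun p : Σ _ : ZMod d, ℕ => p.2)
      (I := fun p => (S.inst p.1 p.2).Coord) ?_ ?_)
  · exact Feasible.add (Feasible.var _) (Feasible.const _)
  · exact h.gateVal.reindex fun q : Σ p : (Σ _ : ZMod d, ℕ), Fin (p.2 + 1) =>
      ⟨q.1, (S.inst q.1.1 q.1.2).recIn q.2⟩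
  · exact h.gateVal.reindex fun q : Σ p : (Σ _ : ZMod d, ℕ), Fin (S.inst p.1 p.2).numAux =>
      ⟨q.1, (S.inst q.1.1 q.1.2).recAux q.2⟩

end NetworkData

theorem Feasible.eqInd {B : Set (ℝ → ℝ)} {e : ℕ} {P : Type} {w : P → ℕ} {I : P → Type}
    {f : ∀ p, (I p → ℝ) → ℝ} (j : P → ℕ) (hB : signFn ∈ B) (hf : Feasible B e w f) :
    Feasible B e w fun p x => RecCirc.eqInd (f p x) (j p) :=
  (Feasible.func (fun _ => hB) (hf.sub (Feasible.const fun p => (j p - 1 / 2 : ℝ)))).mul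
    (Feasible.func (fun _ => hB) ((Feasible.const fun p => (j p + 1 / 2 : ℝ)).sub hf))

/-! ### Feasibility of functions of the global state -/

namespace NetworkData

variable {d : ℕ} {S : NetworkData d} {F : CircuitClass} {A : Set (ℝ → ℝ)}

theorem signFn_mem : signFn ∈ (F.withSign.adjoin A).gates := .inl (.inr rfl)

variable (S F A) in
/-- Feasibility of functions of the state of the simulation on graphs of order `ord p`. -/
abbrev StateFeas {P : Type} (ord : P → ℕ) (f : ∀ p, (S.StateCoord (ord p) → ℝ) → ℝ) : Prop :=
  Feas F A ord (I := fun p => S.StateCoord (ord p)) f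

section Order

variable {P : Type} {ord : P → ℕ}

theorem polyBdd_fin : PolyBdd ord fun p => Fintype.card (Fin (ord p)) := by
  simpa using PolyBdd.self

theorem feas_adj (u v : ∀ p, Fin (ord p)) : StateFeas S F A ord fun p s => S.adj s (u p) (v p) :=
  Feasible.var _

theorem feas_feat (v : ∀ p, Fin (ord p)) : StateFeas S F A ord fun p s => S.feat s (v p) :=
  Feasible.var _

theorem feas_cnt : StateFeas S F A ord fun _ s => S.cnt s := Feasible.var _

theorem feas_fresh : StateFeas S F A ord fun _ s => S.fresh s := Feasible.var _

theorem feas_phase (c : P → ZMod d) : StateFeas S F A ord fun p s => S.phase s (c p) :=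
  Feasible.var _

theorem feas_deg (w : ∀ p, Fin (ord p)) : StateFeas S F A ord fun p s => S.deg s (w p) :=
  Feasible.sum (feas_adj (ord := fun q : Σ p, Fin (ord p) => ord q.1) (fun q => w q.1)
    fun q => q.2) polyBdd_fin

theorem feas_sel (q : ∀ p, Inst d (ord p)) : StateFeas S F A ord fun p s => S.sel s (q p) :=
  (feas_phase _).mul (Feasible.eqInd _ signFn_mem (feas_deg _))

theorem feas_before (w u : ∀ p, Fin (ord p)) :
    StateFeas S F A ord fun p s => S.before s (w p) (u p) :=
  Feasible.sum (Feasible.mul (Feasible.const _)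
    (feas_adj (ord := fun q : Σ p, Fin (ord p) => ord q.1) (fun q => w q.1) fun q => q.2))
    polyBdd_fin

theorem feas_nbr (w : ∀ p, Fin (ord p)) (j : P → ℕ) :
    StateFeas S F A ord fun p s => S.nbr s (w p) (j p) := by
  refine Feasible.sum (J := fun p => Fin (ord p))
    (f := fun p u s => S.feat s u * (S.adj s (w p) u * RecCirc.eqInd (S.before s (w p) u) (j p)))
    ?_ polyBdd_fin
  have h1 := feas_feat (S := S) (F := F) (A := A) (ord := fun q : Σ p, Fin (ord p) => ord q.1)
    fun q => q.2
  have h2 := feas_adj (S := S) (F := F) (A := A) (ord := fun q : Σ p, Fin (ord p) => ord q.1)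
    (fun q => w q.1) fun q => q.2
  have h3 := feas_before (S := S) (F := F) (A := A)
    (ord := fun q : Σ p, Fin (ord p) => ord q.1) (fun q => w q.1) fun q => q.2
  have h4 := h3.eqInd (fun q => j q.1) signFn_mem
  exact h1.mul (h2.mul h4)

theorem feas_loaded (q : ∀ p, Inst d (ord p)) :
    StateFeas S F A (fun r : Σ p, (S.inst (q p).2.1 (q p).2.2).Coord => ord r.1)
      fun r s => S.loaded s (q r.1) r.2 := by
  refine Feasible.sumCases (w := ord) (I := fun p => S.StateCoord (ord p)) (Feasible.const _)
    (Feasible.sumCases (w := ord) (I := fun p => S.StateCoord (ord p))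
      (Feasible.finCases (w := ord) (I := fun p => S.StateCoord (ord p)) ?_ ?_)
      (Feasible.const _))
  · exact feas_feat _
  · exact feas_nbr (ord := fun r : Σ p, Fin (q p).2.2 => ord r.1) (fun r => (q r.1).1) fun r => r.2

theorem feas_cur (q : ∀ p, Inst d (ord p)) :
    StateFeas S F A (fun r : Σ p, (S.inst (q p).2.1 (q p).2.2).Coord => ord r.1)
      fun r s => S.cur s (q r.1) r.2 :=
  Feasible.select feas_fresh (Feasible.var _) (feas_loaded q)

variable [NeZero d]

theorem polyBdd_zmod_fin : PolyBdd ord fun p => Fintype.card (ZMod d × Fin (ord p)) := by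
  simpa using (PolyBdd.const d).mul (PolyBdd.self (w := ord))

theorem polyBdd_inst : PolyBdd ord fun p => Fintype.card (Inst d (ord p)) := by
  simpa using PolyBdd.self.mul ((PolyBdd.const d).mul (PolyBdd.self (w := ord)))

/-- Bounds in the degree index of an instance become bounds in the order of the graph, since the
index is smaller than the order. The same change of weight recurs for `flag`, `curOut` and
`curStep`. -/
theorem IsOfClass.polyBdd_instCoord (h : S.IsOfClass F A) (q : ∀ p, Inst d (ord p)) :
    PolyBdd ord fun p => Fintype.card (S.inst (q p).2.1 (q p).2.2).Coord :=
  h.polyBdd_coord.trans (φ := fun p => ⟨(q p).2.1, (q p).2.2⟩)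
    (PolyBdd.self.mono fun p => (q p).2.2.2.le)

theorem IsOfClass.polyBdd_auxCoord (h : S.IsOfClass F A) :
    PolyBdd ord fun p => Fintype.card (S.AuxCoord (ord p)) := by
  have h1 : PolyBdd ord fun p =>
      Fintype.card (Σ q : Inst d (ord p), (S.inst q.2.1 q.2.2).Coord) := by
    simp only [Fintype.card_sigma]
    exact PolyBdd.sigma (J := fun p => Inst d (ord p))
      (b := fun q => Fintype.card (S.inst q.2.2.1 q.2.2.2).Coord)
      polyBdd_inst
      (h.polyBdd_instCoord (ord := fun q : Σ p, Inst d (ord p) => ord q.1) fun q => q.2)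
  have h2 := (PolyBdd.const (w := ord) 2).add ((PolyBdd.const d).add h1)
  exact h2.mono fun p => by simp

theorem IsOfClass.flag (h : S.IsOfClass F A) (q : ∀ p, Inst d (ord p)) :
    StateFeas S F A ord fun p s => S.flag s (q p) :=
  Feasible.subst
    ((h.haltFlag.reindex fun p => ⟨(q p).2.1, (q p).2.2⟩).reweight
      (PolyBdd.self.mono fun p => (q p).2.2.2.le))
    (feas_cur q) (h.polyBdd_instCoord q)

theorem IsOfClass.curOut (h : S.IsOfClass F A) (q : ∀ p, Inst d (ord p)) :
    StateFeas S F A ord fun p s =>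
      (S.inst (q p).2.1 (q p).2.2).firstOut (S.cur s (q p)) :=
  Feasible.subst
    ((h.firstOut.reindex fun p => ⟨(q p).2.1, (q p).2.2⟩).reweight
      (PolyBdd.self.mono fun p => (q p).2.2.2.le))
    (feas_cur q) (h.polyBdd_instCoord q)

theorem IsOfClass.curStep (h : S.IsOfClass F A) (q : ∀ p, Inst d (ord p))
    (x : ∀ p, (S.inst (q p).2.1 (q p).2.2).Coord) :
    StateFeas S F A ord fun p s =>
      (S.inst (q p).2.1 (q p).2.2).frozenStep (S.instHalt (q p).2.1 (q p).2.2)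
        (S.cur s (q p)) (x p) :=
  Feasible.subst
    ((h.frozenStep.reindex fun p => ⟨⟨(q p).2.1, (q p).2.2⟩, x p⟩).reweight
      (PolyBdd.self.mono fun p => (q p).2.2.2.le))
    (feas_cur q) (h.polyBdd_instCoord q)

theorem IsOfClass.allHalted (h : S.IsOfClass F A) :
    StateFeas S F A ord fun _ s => S.allHalted s := by
  refine Feasible.prod (J := fun p => Fin (ord p)) ?_ polyBdd_fin
  refine Feasible.sum (J := fun r : Σ p, Fin (ord p) => ZMod d × Fin (ord r.1)) ?_ polyBdd_zmod_fin
  let q : ∀ r : Σ r : Σ p, Fin (ord p), ZMod d × Fin (ord r.1), Inst d (ord r.1.1) :=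
    fun r => (r.1.2, r.2)
  exact (feas_sel q).mul (h.flag q)

theorem IsOfClass.newFeat (h : S.IsOfClass F A) (v : ∀ p, Fin (ord p)) :
    StateFeas S F A ord fun p s => S.newFeat s (v p) := by
  refine Feasible.sum (J := fun p => ZMod d × Fin (ord p)) ?_ polyBdd_zmod_fin
  let q : ∀ r : Σ p, ZMod d × Fin (ord p), Inst d (ord r.1) := fun r => (v r.1, r.2)
  exact (feas_sel q).mul (Feasible.func (fun r => .inr (h.act r.2.1)) (h.curOut q))

theorem IsOfClass.haltVal (h : S.IsOfClass F A) :
    StateFeas S F A ord fun _ s => S.haltVal s := by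
  refine h.allHalted.mul ?_
  have h1 := ((h.outerHalt.feasible_value (F.withSign_gates_subset_adjoin A)).reindex
    fun p : P => ⟨ord p + 1, (S.outerHalt (ord p + 1)).outGate 0⟩).reweight
      (PolyBdd.self.add (PolyBdd.const 1))
  refine Feasible.subst (I := fun p => S.StateCoord (ord p))
    (M := fun p => Fin (ord p + 1) ⊕ Fin 0)
    (g := fun p => Sum.elim (fun j s => (Fin.cons (S.cnt s) (S.newFeat s) : Fin _ → ℝ) j)
      fun j _ => Fin.elim0 j) h1 ?_ ?_
  · refine Feasible.sumCases (w := ord) (I := fun p => S.StateCoord (ord p))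
      (Feasible.finCases (w := ord) (I := fun p => S.StateCoord (ord p)) ?_ ?_) ?_
    · exact feas_cnt
    · exact h.newFeat (ord := fun r : Σ p, Fin (ord p) => ord r.1) fun r => r.2
    · exact Feasible.const _
  · simpa using PolyBdd.self.add (PolyBdd.const 1)

end Order

variable [NeZero d]

theorem IsOfClass.result (h : S.IsOfClass F A) :
    StateFeas S F A (fun q : Σ n, InCoord n => q.1) fun q s => S.result s q.2 := by
  refine Feasible.sumCases (w := id) (I := fun n => S.StateCoord n) ?_ ?_
  · exact feas_adj (ord := fun q : Σ n, Fin n × Fin n => q.1) (fun q => q.2.1) fun q => q.2.2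
  · exact h.newFeat (ord := fun q : Σ n, Fin n => q.1) fun q => q.2

theorem IsOfClass.next (h : S.IsOfClass F A) :
    StateFeas S F A (fun q : Σ n, S.StateCoord n => q.1) fun q s => S.next s q.2 := by
  refine Feasible.sumCases (w := id) (I := fun n => S.StateCoord n)
    (Feasible.sumCases (w := id) (I := fun n => S.StateCoord n) ?_ ?_)
    (Feasible.sumCases (w := id) (I := fun n => S.StateCoord n)
      (Feasible.sumCases (w := id) (I := fun n => S.StateCoord n) ?_ ?_)
      (Feasible.sumCases (w := id) (I := fun n => S.StateCoord n) ?_ ?_))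
  · exact feas_adj (ord := fun q : Σ n, Fin n × Fin n => q.1) (fun q => q.2.1) fun q => q.2.2
  · have h1 := h.allHalted (ord := fun q : Σ n : ℕ, Fin n => q.1)
    have h2 := feas_feat (S := S) (F := F) (A := A) (ord := fun q : Σ n : ℕ, Fin n => q.1)
      fun q => q.2
    have h3 := h.newFeat (ord := fun q : Σ n : ℕ, Fin n => q.1) fun q => q.2
    exact h1.select h2 h3
  · have h1 := h.allHalted (ord := fun q : Σ _ : ℕ, Unit => q.1)
    have h2 := feas_cnt (S := S) (F := F) (A := A) (ord := fun q : Σ _ : ℕ, Unit => q.1)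
    exact h2.add h1
  · exact h.allHalted (ord := fun q : Σ _ : ℕ, Unit => q.1)
  · have h1 := h.allHalted (ord := fun q : Σ _ : ℕ, ZMod d => q.1)
    have h2 := feas_phase (S := S) (F := F) (A := A) (ord := fun q : Σ _ : ℕ, ZMod d => q.1)
      fun q => q.2
    have h3 := feas_phase (S := S) (F := F) (A := A) (ord := fun q : Σ _ : ℕ, ZMod d => q.1)
      fun q => q.2 - 1
    exact h1.select h2 h3
  · exact h.curStep
      (ord := fun r : Σ n, (Σ q : Inst d n, (S.inst q.2.1 q.2.2).Coord) => r.1)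
      (fun r => r.2.1) fun r => r.2.2

end NetworkData

/-! ### Correctness of the simulation of recurrent circuits -/

namespace RecCircuit

variable {n m : ℕ} (R : RecCircuit n m)

theorem eval_eq_some {x : Fin n → ℝ} {k : ℕ} (hk : R.HaltsAt x k)
    (hlt : ∀ j < k, ¬ R.HaltsAt x j) :
    R.eval x = Part.some (R.circ.eval (R.memory x k).1 (R.memory x k).2) := by
  classical
  have h : ∃ k, R.HaltsAt x k := ⟨k, hk⟩
  have hf : Nat.find h = k := (Nat.find_eq_iff h).2 ⟨hk, fun j hj => hlt j hj⟩
  rw [eval, Part.assert_pos h, ← hf]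

theorem eval_eq_none {x : Fin n → ℝ} (h : ¬ ∃ k, R.HaltsAt x k) : R.eval x = Part.none := by
  rw [eval, Part.assert_neg h]

theorem eval_dom {x : Fin n → ℝ} : (R.eval x).Dom ↔ ∃ k, R.HaltsAt x k :=
  ⟨fun h => h.1, fun h => ⟨h, trivial⟩⟩

/-- The state in iteration `k + 1`. -/
def stateAt (x : Fin n → ℝ) (k : ℕ) : R.Coord → ℝ :=
  Sum.elim (fun _ => (k : ℝ) + 1) (Sum.elim (R.memory x k).1 (R.memory x k).2)

theorem initState_eq (x : Fin n → ℝ) : R.initState x = R.stateAt x 0 := by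
  funext c
  rcases c with _ | _ | _ <;> simp [initState, stateAt, memory]

theorem stepState_stateAt (x : Fin n → ℝ) (k : ℕ) :
    R.stepState (R.stateAt x k) = R.stateAt x (k + 1) := by
  funext c
  rcases c with _ | _ | _ <;> simp [stepState, stateAt, memory, gateVal]

variable {R} {D : Circuit (R.numHalt + 1) 1}

open Classical in
theorem haltFlag_stateAt (hD : ComputesHalt D R.halt) (x : Fin n → ℝ) (k : ℕ) :
    R.haltFlag D (R.stateAt x k) = if R.HaltsAt x k then 1 else 0 := by
  have h := hD k.succPNat
    (fun j => R.circ.value (R.memory x k).1 (R.memory x k).2 (R.haltGate j))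
  rw [haltFlag]
  simp only [Nat.succPNat_coe, Nat.succ_eq_add_one, Nat.cast_add, Nat.cast_one] at h
  exact h.trans (if_congr Iff.rfl rfl rfl)

theorem frozenStep_of_halts (hD : ComputesHalt D R.halt) {x : Fin n → ℝ} {k : ℕ}
    (h : R.HaltsAt x k) : R.frozenStep D (R.stateAt x k) = R.stateAt x k := by
  funext c
  simp [frozenStep, haltFlag_stateAt hD, h]

theorem frozenStep_of_not_halts (hD : ComputesHalt D R.halt) {x : Fin n → ℝ} {k : ℕ}
    (h : ¬ R.HaltsAt x k) : R.frozenStep D (R.stateAt x k) = R.stateAt x (k + 1) := by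
  funext c
  simp [frozenStep, haltFlag_stateAt hD, h, stepState_stateAt]

theorem frozenStep_iterate_of_not_halts (hD : ComputesHalt D R.halt) {x : Fin n → ℝ} {k : ℕ}
    (h : ∀ j < k, ¬ R.HaltsAt x j) : (R.frozenStep D)^[k] (R.initState x) = R.stateAt x k := by
  induction k with
  | zero => exact R.initState_eq x
  | succ k ih =>
    rw [Function.iterate_succ_apply', ih fun j hj => h j (hj.trans k.lt_succ_self),
      frozenStep_of_not_halts hD (h k k.lt_succ_self)]

/-- The orbit follows the computation up to the first halting iteration `T`, and its state there is
a fixed point of `frozenStep`. -/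
theorem frozenStep_iterate_of_halts (hD : ComputesHalt D R.halt) {x : Fin n → ℝ} {k : ℕ}
    (h : ∃ j ≤ k, R.HaltsAt x j) :
    ∃ T, R.HaltsAt x T ∧ (∀ j < T, ¬ R.HaltsAt x j) ∧
      (R.frozenStep D)^[k] (R.initState x) = R.stateAt x T := by
  classical
  obtain ⟨j, hj, hjk⟩ := h
  have h : ∃ k, R.HaltsAt x k := ⟨j, hjk⟩
  refine ⟨Nat.find h, Nat.find_spec h, fun i hi => Nat.find_min h hi, ?_⟩
  obtain ⟨i, rfl⟩ := Nat.exists_eq_add_of_le' ((Nat.find_min' h hjk).trans hj)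
  rw [Function.iterate_add_apply,
    frozenStep_iterate_of_not_halts hD fun j hj => Nat.find_min h hj]
  exact Function.iterate_fixed (frozenStep_of_halts hD (Nat.find_spec h)) i

open Classical in
-- Freezing makes the flag permanent, so that flags raised at different times by different vertices
-- can be combined by a product.
theorem haltFlag_iterate (hD : ComputesHalt D R.halt) (x : Fin n → ℝ) (k : ℕ) :
    R.haltFlag D ((R.frozenStep D)^[k] (R.initState x)) =
      if ∃ j ≤ k, R.HaltsAt x j then 1 else 0 := by
  split_ifs with h
  · obtain ⟨T, hT, -, hs⟩ := frozenStep_iterate_of_halts hD h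
    rw [hs, haltFlag_stateAt hD, if_pos hT]
  · push Not at h
    rw [frozenStep_iterate_of_not_halts hD fun j hj => h j hj.le, haltFlag_stateAt hD,
      if_neg (h k le_rfl)]

end RecCircuit

theorem RecFamily.eval_ofFn (R : RecFamily) {r : ℕ} (x : Fin r → ℝ) :
    R.eval (List.ofFn x) = ((R.circuit r).eval x).map List.ofFn := by
  -- The length of the list is made a variable, so that substituting it removes the cast between the
  -- circuits for `(List.ofFn x).length` and `r` inputs.
  have key : ∀ (l : List ℝ) (h : l.length = r), (∀ j : Fin r, l.get (j.cast h.symm) = x j) →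
      R.eval l = ((R.circuit r).eval x).map List.ofFn := by
    rintro l rfl h
    rw [RecFamily.eval, show l.get = x from funext h]
  exact key _ (List.length_ofFn) fun j => by simp

/-! ### Recurrent circuits for real-valued functions -/

section RealValued

variable {f : List ℝ →. ℝ} {Q : RecFamily} {r : ℕ}

theorem dom_iff_haltsAt (hf : (fun x => (f x).map fun y => [y]) = Q.eval) (x : Fin r → ℝ) :
    (f (List.ofFn x)).Dom ↔ ∃ k, (Q.circuit r).HaltsAt x k := by
  have h := congrFun hf (List.ofFn x)
  rw [Q.eval_ofFn] at h
  rw [← RecCircuit.eval_dom]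
  exact iff_of_eq (congrArg Part.Dom h)

theorem firstOut_iterate (hf : (fun x => (f x).map fun y => [y]) = Q.eval)
    {D : Circuit ((Q.circuit r).numHalt + 1) 1} (hD : ComputesHalt D (Q.circuit r).halt)
    {x : Fin r → ℝ} {k : ℕ} (h : ∃ j ≤ k, (Q.circuit r).HaltsAt x j)
    (hd : (f (List.ofFn x)).Dom) :
    (Q.circuit r).firstOut
      (((Q.circuit r).frozenStep D)^[k] ((Q.circuit r).initState x)) =
      (f (List.ofFn x)).get hd := by
  obtain ⟨T, hT, hlt, hs⟩ := RecCircuit.frozenStep_iterate_of_halts hD h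
  have h := congrFun hf (List.ofFn x)
  rw [Q.eval_ofFn, RecCircuit.eval_eq_some _ hT hlt, Part.map_some] at h
  rw [hs]
  have h1 : (f (List.ofFn x)).get hd ∈ f (List.ofFn x) := Part.get_mem hd
  have h2 := Part.mem_map (fun y => [y]) h1
  rw [h, Part.mem_some_iff] at h2
  -- Where `f` is defined, the output list has length one, so an output gate exists and the default
  -- value in `firstOut` is not used.
  have hm : 0 < Q.numOut r := by
    have := congrArg List.length h2
    simp at this
    omega
  have h3 := congrArg (fun l => l[0]?) h2
  simp [hm] at h3
  rw [RecCircuit.firstOut, dif_pos hm, h3]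
  rfl

end RealValued

/-! ### Neighbours -/

/-- Both thresholds lie halfway between integers, where the value of `sign` at 0 plays no role. -/
theorem eqInd_natCast (k j : ℕ) : eqInd (k : ℝ) j = if k = j then 1 else 0 := by
  unfold eqInd signFn
  rcases lt_trichotomy k j with h | rfl | h
  · have h' : (k : ℝ) + 1 ≤ j := by exact_mod_cast h
    rw [if_neg (by linarith), if_neg h.ne, zero_mul]
  · rw [if_pos (by linarith), if_pos (by linarith), if_pos rfl, one_mul]
  · have h' : (j : ℝ) + 1 ≤ k := by exact_mod_cast h
    rw [if_neg (c := (0 : ℝ) < j + 1 / 2 - k) (by linarith), if_neg h.ne', mul_zero]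

theorem length_filter_finRange {n : ℕ} (p : Fin n → Prop) [DecidablePred p] :
    ((List.finRange n).filter fun u => p u).length = ∑ u, if p u then 1 else 0 := by
  rw [← Finset.card_filter]
  rfl

/-- This expresses list access by sums of indicators, which circuits can evaluate. In the induction
the last index precedes no other, so it leaves the counts of the others unchanged, and its own count
is the length of the filtered list of the others. The default value 0 matches the empty sum. -/
theorem getD_filter_finRange {n : ℕ} (p : Fin n → Prop) [DecidablePred p] (g : Fin n → ℝ) (j : ℕ) :
    (((List.finRange n).filter fun u => p u).map g).getD j 0 =
      ∑ u, if p u ∧ (∑ u', if u' < u ∧ p u' then 1 else 0) = j then g u else 0 := by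
  induction n with
  | zero => simp
  | succ n ih =>
    have h1 := ih (fun u => p u.castSucc) fun u => g u.castSucc
    have h2 := length_filter_finRange fun u => p (Fin.castSucc u)
    have h0 : ∀ u : Fin n, ¬ Fin.last n < u.castSucc := fun u => not_lt.2 (Fin.le_last _)
    rw [List.finRange_succ_last, List.filter_append, List.map_append, List.filter_map, List.map_map,
      Fin.sum_univ_castSucc]
    simp only [Fin.sum_univ_castSucc, Fin.castSucc_lt_castSucc_iff, Fin.castSucc_lt_last, true_and,
      lt_self_iff_false, false_and, if_false, add_zero, h0]
    rw [← h2, ← h1]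
    set l := (List.finRange n).filter fun u => p (Fin.castSucc u) with hl
    change ((l.map fun u => g u.castSucc) ++ _).getD j 0 = _
    rcases lt_or_ge j l.length with hj | hj
    · rw [List.getD_append _ _ _ _ (by simpa using hj), if_neg (by omega), add_zero]
    · rw [List.getD_append_right _ _ _ _ (by simpa using hj),
        List.getD_eq_default (l.map _) _ (by simpa using hj), zero_add]
      by_cases hp : p (Fin.last n)
      · rcases hj.eq_or_lt with rfl | hj'
        · simp [hp]
        · rw [if_neg (by omega), List.getD_eq_default _ _ (by simp [hp]; omega)]
      · simp [hp]

namespace LabelledGraph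

variable (G : LabelledGraph)

open Classical in
/-- The degree of a vertex. -/
def nbrCount (w : Fin G.order) : ℕ :=
  ((List.finRange G.order).filter fun u => G.graph.Adj w u).length

theorem length_neighbourFeatures (h : Fin G.order → ℝ) (w : Fin G.order) :
    (G.neighbourFeatures h w).length = G.nbrCount w := by
  simp [neighbourFeatures, nbrCount]

theorem nbrCount_lt (w : Fin G.order) : G.nbrCount w < G.order := by
  classical
  rw [nbrCount, length_filter_finRange, ← Finset.card_filter]
  -- A vertex is not its own neighbour, so degrees below the order suffice as indices of instances.
  refine (Finset.card_lt_univ_of_notMem (x := w) (by simp)).trans_eq (by simp)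

/-- The arguments of the function of a layer at the vertex `w`, if `w` has degree `m`. -/
def layerInput (h : Fin G.order → ℝ) (w : Fin G.order) (m : ℕ) : Fin (m + 1) → ℝ :=
  Fin.cons (h w) fun j => (G.neighbourFeatures h w).getD j 0

theorem ofFn_layerInput (h : Fin G.order → ℝ) (w : Fin G.order) :
    List.ofFn (G.layerInput h w (G.nbrCount w)) = h w :: G.neighbourFeatures h w := by
  rw [layerInput, List.ofFn_succ]
  simp only [Fin.cons_zero, Fin.cons_succ, List.cons.injEq, true_and]
  refine List.ext_getElem (by simp [length_neighbourFeatures]) fun i h1 h2 => ?_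
  simp [h2]

end LabelledGraph

namespace NetworkData

variable {d : ℕ} {S : NetworkData d} {G : LabelledGraph}

/-! ### Correctness of the simulation of networks -/

variable (S) in
/-- The circuits of the network data compute the functions of the network `N`. -/
structure Represents (N : RecGNN) : Prop where
  fam : ∀ i : ℕ, (fun x => ((N.layer i).1 x).map fun y => [y]) = (S.fam i).eval
  act : ∀ i : ℕ, (N.layer i).2 = S.act i
  haltCirc : ∀ c n, ComputesHalt (S.haltCirc c (((S.fam c).circuit n).numHalt + 1))
    ((S.fam c).circuit n).halt
  outerHalt : ∀ p : ℕ, ComputesHalt (S.outerHalt (p + 1))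
    fun i (v : Fin p → ℝ) => N.halt i (List.ofFn v)

/-- The instance responsible for the vertex `w` in layer `i + 1`. -/
def activeInst (d : ℕ) (G : LabelledGraph) (i : ℕ) (w : Fin G.order) : Inst d G.order :=
  (w, ((i + 1 : ℕ) : ZMod d), ⟨G.nbrCount w, G.nbrCount_lt w⟩)

open Classical in
/-- The state `s` belongs to iteration `k + 1` of layer `i + 1`, applied to the features `H`. -/
structure Simulates (G : LabelledGraph) (i k : ℕ) (H : Fin G.order → ℝ)
    (s : S.StateCoord G.order → ℝ) : Prop where
  adj : ∀ u v, S.adj s u v = if G.graph.Adj u v then 1 else 0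
  feat : ∀ v, S.feat s v = H v
  cnt : S.cnt s = (i : ℝ) + 1
  phase : ∀ c, S.phase s c = if c = ((i + 1 : ℕ) : ZMod d) then 1 else 0
  cur : ∀ w, S.cur s (activeInst d G i w) =
    ((S.inst ((i + 1 : ℕ) : ZMod d) (G.nbrCount w)).frozenStep
      (S.instHalt ((i + 1 : ℕ) : ZMod d) (G.nbrCount w)))^[k]
      ((S.inst ((i + 1 : ℕ) : ZMod d) (G.nbrCount w)).initState (G.layerInput H w (G.nbrCount w)))

variable (S) in
/-- All computations of layer `i + 1` halt within `k + 1` iterations. -/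
def LayerDone (G : LabelledGraph) (i k : ℕ) (H : Fin G.order → ℝ) : Prop :=
  ∀ w, ∃ j ≤ k, (S.inst ((i + 1 : ℕ) : ZMod d) (G.nbrCount w)).HaltsAt
    (G.layerInput H w (G.nbrCount w)) j

section Graph

variable {H : Fin G.order → ℝ} {s : S.StateCoord G.order → ℝ}

open Classical in
theorem deg_eq (hadj : ∀ u v, S.adj s u v = if G.graph.Adj u v then 1 else 0) (w : Fin G.order) :
    S.deg s w = G.nbrCount w := by
  rw [LabelledGraph.nbrCount, length_filter_finRange, deg]
  push_cast
  exact Finset.sum_congr rfl fun u _ => hadj w u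

open Classical in
theorem nbr_eq (hadj : ∀ u v, S.adj s u v = if G.graph.Adj u v then 1 else 0)
    (hfeat : ∀ v, S.feat s v = H v) (w : Fin G.order) (j : ℕ) :
    S.nbr s w j = (G.neighbourFeatures H w).getD j 0 := by
  rw [LabelledGraph.neighbourFeatures, getD_filter_finRange, nbr]
  refine Finset.sum_congr rfl fun u _ => ?_
  have hb : S.before s w u = (∑ u', if u' < u ∧ G.graph.Adj w u' then 1 else 0 : ℕ) := by
    rw [before]
    push_cast
    refine Finset.sum_congr rfl fun u' _ => ?_
    rw [hadj]
    split_ifs <;> simp_all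
  rw [hfeat, hadj, hb, eqInd_natCast]
  split_ifs <;> simp_all

open Classical in
theorem loaded_eq (hadj : ∀ u v, S.adj s u v = if G.graph.Adj u v then 1 else 0)
    (hfeat : ∀ v, S.feat s v = H v) (i : ℕ) (w : Fin G.order) :
    S.loaded s (activeInst d G i w) =
      (S.inst ((i + 1 : ℕ) : ZMod d) (G.nbrCount w)).initState
        (G.layerInput H w (G.nbrCount w)) := by
  rw [loaded]
  refine congrArg (S.inst ((i + 1 : ℕ) : ZMod d) (G.nbrCount w)).initState ?_
  refine congrArg₂ Fin.cons (hfeat w) (funext fun j => nbr_eq hadj hfeat w j)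

end Graph

namespace Simulates

variable {i k : ℕ} {H : Fin G.order → ℝ} {s : S.StateCoord G.order → ℝ}

open Classical in
theorem sel_eq (h : Simulates G i k H s) (w : Fin G.order) (p : ZMod d × Fin G.order) :
    S.sel s (w, p) = if p = (activeInst d G i w).2 then 1 else 0 := by
  rw [sel, h.phase, deg_eq h.adj, eqInd_natCast, ite_mul, one_mul, zero_mul, ← ite_and]
  refine if_congr ?_ rfl rfl
  simp [activeInst, Prod.ext_iff, Fin.ext_iff, eq_comm]

open Classical in
theorem flag_eq {N : RecGNN} (hS : S.Represents N) (h : Simulates G i k H s) (w : Fin G.order) :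
    S.flag s (activeInst d G i w) =
      if ∃ j ≤ k, (S.inst ((i + 1 : ℕ) : ZMod d) (G.nbrCount w)).HaltsAt
        (G.layerInput H w (G.nbrCount w)) j then 1 else 0 := by
  rw [← RecCircuit.haltFlag_iterate (hS.haltCirc ((i + 1 : ℕ) : ZMod d) (G.nbrCount w + 1)),
    ← h.cur]
  rfl

variable [NeZero d]

/-- Whatever the inactive instances compute is a real number multiplied by 0, so nothing has to be
known about their states. -/
theorem sum_sel (h : Simulates G i k H s) (w : Fin G.order) (g : ZMod d × Fin G.order → ℝ) :
    ∑ p, S.sel s (w, p) * g p = g (activeInst d G i w).2 := by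
  classical
  simp [h.sel_eq]

open Classical in
-- Each inner sum collapses to the flag of the active instance, and a product of flags with values 0
-- and 1 is their conjunction.
theorem allHalted_eq {N : RecGNN} (hS : S.Represents N) (h : Simulates G i k H s) :
    S.allHalted s = if S.LayerDone G i k H then 1 else 0 := by
  rw [allHalted]
  have h1 : ∀ w, ∑ p : ZMod d × Fin G.order, S.sel s (w, p) * S.flag s (w, p) =
      if ∃ j ≤ k, (S.inst ((i + 1 : ℕ) : ZMod d) (G.nbrCount w)).HaltsAt
        (G.layerInput H w (G.nbrCount w)) j then 1 else 0 := fun w => by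
    rw [h.sum_sel w fun p => S.flag s (w, p), ← h.flag_eq hS]
    rfl
  simp only [h1]
  rw [Finset.prod_ite_zero]
  simp only [Finset.mem_univ, true_implies, Finset.prod_const_one]
  exact if_congr Iff.rfl rfl rfl

/-- The new flag for a first iteration is 0, so the current states are the stored ones, advanced by
one frozen step. -/
theorem next_of_not_done {N : RecGNN} (hS : S.Represents N) (h : Simulates G i k H s)
    (hn : ¬ S.LayerDone G i k H) : Simulates G i (k + 1) H (S.next s) := by
  classical
  have ha : S.allHalted s = 0 := by rw [h.allHalted_eq hS, if_neg hn]
  refine ⟨h.adj, fun v => ?_, ?_, fun c => ?_, fun w => ?_⟩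
  · change (1 - S.allHalted s) * S.feat s v + S.allHalted s * S.newFeat s v = _
    rw [ha, h.feat]
    ring
  · change S.cnt s + S.allHalted s = _
    rw [ha, h.cnt, add_zero]
  · change (1 - S.allHalted s) * S.phase s c + S.allHalted s * S.phase s (c - 1) = _
    rw [ha, ← h.phase]
    ring
  · rw [Function.iterate_succ_apply', ← h.cur]
    funext x
    change (1 - S.allHalted s) * (S.inst _ _).frozenStep (S.instHalt _ _) (S.cur s _) x +
      S.allHalted s * _ = _
    rw [ha, sub_zero, one_mul, zero_mul, add_zero]
    rfl

/-- The new flag for a first iteration is 1, so the stored states are overridden by initial states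
loaded from the new features; hence the iteration counter of the invariant restarts at 0. -/
theorem next_of_done {N : RecGNN} (hS : S.Represents N) (h : Simulates G i k H s)
    (hn : S.LayerDone G i k H) : Simulates G (i + 1) 0 (S.newFeat s) (S.next s) := by
  classical
  have ha : S.allHalted s = 1 := by rw [h.allHalted_eq hS, if_pos hn]
  have hf : ∀ v, S.feat (S.next s) v = S.newFeat s v := fun v => by
    change (1 - S.allHalted s) * S.feat s v + S.allHalted s * S.newFeat s v = _
    rw [ha]
    ring
  refine ⟨h.adj, hf, ?_, fun c => ?_, fun w => ?_⟩
  · change S.cnt s + S.allHalted s = _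
    rw [ha, h.cnt]
    push_cast
    ring
  · change (1 - S.allHalted s) * S.phase s c + S.allHalted s * S.phase s (c - 1) = _
    rw [ha, h.phase (c - 1), sub_self, zero_mul, zero_add, one_mul]
    refine if_congr ?_ rfl rfl
    -- The residue `c - 1` is that of layer `i + 1` exactly if `c` is that of layer `i + 2`.
    rw [sub_eq_iff_eq_add, Nat.cast_succ (i + 1)]
  · funext x
    change (1 - S.allHalted s) * _ +
      S.allHalted s * S.loaded (S.next s) (activeInst d G (i + 1) w) x = _
    rw [ha, sub_self, zero_mul, zero_add, one_mul, loaded_eq (s := S.next s) h.adj hf]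
    rfl

end Simulates

/-! ### Layers of the network and the ends of their simulations -/

section Features

variable {N : RecGNN} {i k : ℕ} {H : Fin G.order → ℝ}

theorem features_succ (hH : H ∈ N.features G i) :
    N.features G (i + 1) =
      ⟨∀ w, ((N.layer (i + 1)).1 (H w :: G.neighbourFeatures H w)).Dom,
        fun hd w => (N.layer (i + 1)).2
          (((N.layer (i + 1)).1 (H w :: G.neighbourFeatures H w)).get (hd w))⟩ := by
  rw [RecGNN.features, Part.eq_some_iff.2 hH, Part.bind_some]

theorem layer_dom_iff (hS : S.Represents N) (w : Fin G.order) :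
    ((N.layer (i + 1)).1 (H w :: G.neighbourFeatures H w)).Dom ↔
      ∃ j, (S.inst ((i + 1 : ℕ) : ZMod d) (G.nbrCount w)).HaltsAt
        (G.layerInput H w (G.nbrCount w)) j := by
  rw [← G.ofFn_layerInput]
  exact dom_iff_haltsAt (hS.fam (i + 1)) _

/-- Finitely many vertices have a common bound for their halting times. -/
theorem exists_layerDone (hS : S.Represents N) (hH : H ∈ N.features G i)
    (hd : (N.features G (i + 1)).Dom) : ∃ k, S.LayerDone G i k H := by
  rw [features_succ hH] at hd
  choose j hj using fun w => (layer_dom_iff hS w).1 (hd w)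
  exact ⟨Finset.univ.sup j, fun w => ⟨j w, Finset.le_sup (Finset.mem_univ w), hj w⟩⟩

variable [NeZero d] {s : S.StateCoord G.order → ℝ}

theorem newFeat_mem_features (hS : S.Represents N) (hH : H ∈ N.features G i)
    (h : Simulates G i k H s) (hn : S.LayerDone G i k H) :
    S.newFeat s ∈ N.features G (i + 1) := by
  rw [features_succ hH]
  refine ⟨fun w => (layer_dom_iff hS w).2 ((hn w).imp fun j hj => hj.2), funext fun w => ?_⟩
  rw [newFeat, h.sum_sel w fun p => S.act p.1 ((S.inst p.1 p.2).firstOut (S.cur s (w, p))),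
    hS.act]
  refine congrArg (S.act ((i + 1 : ℕ) : ZMod d)) ?_
  have h1 := firstOut_iterate (hS.fam (i + 1)) (hS.haltCirc _ _) (hn w)
    ((dom_iff_haltsAt (hS.fam (i + 1)) _).2 ((hn w).imp fun j hj => hj.2))
  have h2 := congrArg (S.inst ((i + 1 : ℕ) : ZMod d) (G.nbrCount w)).firstOut (h.cur w)
  refine Eq.trans ?_ (h2.trans h1).symm
  congr 2
  rw [G.ofFn_layerInput]

open Classical in
theorem haltVal_of_done (hS : S.Represents N) (h : Simulates G i k H s)
    (hn : S.LayerDone G i k H) :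
    S.haltVal s = if N.halt i.succPNat (List.ofFn (S.newFeat s)) = true then 1 else 0 := by
  rw [haltVal, h.allHalted_eq hS, if_pos hn, one_mul, h.cnt]
  have h1 := hS.outerHalt G.order i.succPNat (S.newFeat s)
  simp only [Nat.succPNat_coe, Nat.succ_eq_add_one, Nat.cast_add, Nat.cast_one] at h1
  rw [h1]

theorem haltVal_of_not_done (hS : S.Represents N) (h : Simulates G i k H s)
    (hn : ¬ S.LayerDone G i k H) : S.haltVal s = 0 := by
  classical
  rw [haltVal, h.allHalted_eq hS, if_neg hn, zero_mul]

end Features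

/-! ### Runs of the simulation -/

section Run

variable [NeZero d] {N : RecGNN} {s : S.StateCoord G.order → ℝ}

/-- Every completed layer consults the outer halting function. As long as the halting gate has not
fired, none of the completed layers is a halting one, so the first time it fires belongs to the
first halting layer. -/
theorem simulates_of_not_halting (hS : S.Represents N) (h : Simulates G 0 0 G.feature s) (t : ℕ)
    (ht : ∀ t' < t, ¬ 0 < S.haltVal (S.next^[t'] s)) :
    ∃ i k H, H ∈ N.features G i ∧ Simulates G i k H (S.next^[t] s) ∧
      ∀ j < i, ¬ N.HaltsAt G j := by
  induction t with
  | zero => exact ⟨0, 0, G.feature, Part.mem_some _, h, by simp⟩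
  | succ t ih =>
    obtain ⟨i, k, H, hH, hs, hj⟩ := ih fun t' ht' => ht t' (ht'.trans t.lt_succ_self)
    rw [Function.iterate_succ_apply']
    by_cases hn : S.LayerDone G i k H
    · have hm := newFeat_mem_features hS hH hs hn
      refine ⟨i + 1, 0, _, hm, hs.next_of_done hS hn, fun j hj' => ?_⟩
      rcases (Nat.lt_succ_iff.1 hj').lt_or_eq with hlt | rfl
      · exact hj j hlt
      · rintro ⟨H', hH', hh⟩
        refine ht t t.lt_succ_self ?_
        rw [Part.mem_unique hH' hm] at hh
        rw [haltVal_of_done hS hs hn, if_pos hh]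
        exact one_pos
    · exact ⟨i, k + 1, H, hH, hs.next_of_not_done hS hn, hj⟩

/-- The minimal `k` is taken, since the invariant stays within the layer only while the layer is not
done. -/
theorem exists_layer_end (hS : S.Represents N) {i : ℕ} {H : Fin G.order → ℝ}
    (hH : H ∈ N.features G i) (hd : (N.features G (i + 1)).Dom) (h : Simulates G i 0 H s) :
    ∃ t k, S.LayerDone G i k H ∧ Simulates G i k H (S.next^[t] s) := by
  classical
  have hk := exists_layerDone hS hH hd
  refine ⟨Nat.find hk, Nat.find hk, Nat.find_spec hk, ?_⟩
  have key : ∀ k ≤ Nat.find hk, Simulates G i k H (S.next^[k] s) := by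
    intro k
    induction k with
    | zero => exact fun _ => h
    | succ k ih =>
      intro hle
      rw [Function.iterate_succ_apply']
      exact (ih (by omega)).next_of_not_done hS (Nat.find_min hk hle)
  exact key _ le_rfl

/-- The map `next` is iterated regardless of the halting gate, so reaching a layer only requires
that its initial features are defined. -/
theorem exists_layer_start (hS : S.Represents N) (h : Simulates G 0 0 G.feature s) (i : ℕ)
    (hd : (N.features G i).Dom) :
    ∃ t, ∃ H ∈ N.features G i, Simulates G i 0 H (S.next^[t] s) := by
  induction i with
  | zero => exact ⟨0, G.feature, Part.mem_some _, h⟩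
  | succ i ih =>
    have hd' : (N.features G i).Dom := hd.1
    obtain ⟨t, H, hH, hs⟩ := ih hd'
    obtain ⟨t', k, hn, hs'⟩ := exists_layer_end hS hH hd hs
    refine ⟨t' + t + 1, _, newFeat_mem_features hS hH hs' hn, ?_⟩
    rw [Function.iterate_succ_apply', Function.iterate_add_apply]
    exact hs'.next_of_done hS hn

theorem exists_halting (hS : S.Represents N) (h : Simulates G 0 0 G.feature s) {i : ℕ}
    (hi : N.HaltsAt G i) : ∃ t, 0 < S.haltVal (S.next^[t] s) := by
  obtain ⟨H', hH', hh⟩ := hi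
  have hd : (N.features G (i + 1)).Dom := Part.dom_iff_mem.2 ⟨H', hH'⟩
  obtain ⟨t, H, hH, hs⟩ := exists_layer_start hS h i hd.1
  obtain ⟨t', k, hn, hs'⟩ := exists_layer_end hS hH hd hs
  refine ⟨t' + t, ?_⟩
  rw [Function.iterate_add_apply, haltVal_of_done hS hs' hn,
    Part.mem_unique (newFeat_mem_features hS hH hs' hn) hH', if_pos hh]
  exact one_pos

open Classical in
theorem result_of_first_halting (hS : S.Represents N) (h : Simulates G 0 0 G.feature s) {t : ℕ}
    (ht : 0 < S.haltVal (S.next^[t] s)) (hlt : ∀ t' < t, ¬ 0 < S.haltVal (S.next^[t'] s)) :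
    ∃ H', N.eval G = Part.some ⟨G.order, G.graph, H'⟩ ∧
      S.result (S.next^[t] s) =
        Sum.elim (fun p => if G.graph.Adj p.1 p.2 then 1 else 0) H' := by
  obtain ⟨i, k, H, hH, hs, hj⟩ := simulates_of_not_halting hS h t hlt
  by_cases hn : S.LayerDone G i k H
  · rw [haltVal_of_done hS hs hn] at ht
    have hh : N.halt i.succPNat (List.ofFn (S.newFeat (S.next^[t] s))) = true := by
      by_contra hc
      simp [hc] at ht
    have hm := newFeat_mem_features hS hH hs hn
    have hi : N.HaltsAt G i := ⟨_, hm, hh⟩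
    have hex : ∃ i, N.HaltsAt G i := ⟨i, hi⟩
    have hf : Nat.find hex = i := (Nat.find_eq_iff hex).2 ⟨hi, hj⟩
    refine ⟨S.newFeat (S.next^[t] s), ?_, ?_⟩
    · rw [RecGNN.eval, Part.assert_pos hex, hf, Part.eq_some_iff.2 hm, Part.map_some]
    · funext c
      rcases c with p | v
      · exact hs.adj p.1 p.2
      · rfl
  · rw [haltVal_of_not_done hS hs hn] at ht
    exact absurd ht (lt_irrefl _)

end Run

end NetworkData

/-! ### Recurrent circuits from feasible dynamical systems -/

/-- The whole halting decision is prepared in a single gate of the underlying circuit; the halting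
function only tests whether its value is positive. -/
theorem exists_haltCircuits (F : CircuitClass) :
    ∃ D : ∀ k, Circuit k 1, F.withSign.IsFamily D ∧
      ComputesHalt (D (1 + 1)) fun _ (v : Fin 1 → ℝ) => decide (0 < v 0) := by
  obtain ⟨D, hD, hv⟩ := exists_isFamily_of_feasible (F := F.withSign)
    -- Input 0 is the iteration number, so the value of the halting gate is input 1. The default
    -- only serves circuits with fewer than two inputs.
    (f := fun k x => signFn (if h : 1 < k then x ⟨1, h⟩ else 0)) <| by
      refine Feasible.func (fun _ => F.signFn_mem_withSign) ?_
      refine Feasible.of_bound (PolyBdd.const 1) (Feasible.const_depth 0) fun k => ?_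
      by_cases h : 1 < k
      · simpa only [h, dif_pos] using NetComputable.var _
      · simpa only [h, dif_neg, not_false_eq_true] using NetComputable.const _
  refine ⟨D, hD, fun i v => ?_⟩
  rw [hv]
  simp only [signFn, decide_eq_true_eq]
  rfl

/-- The coordinates in `X` become input gates and those in `Y` auxiliary memory gates. One circuit
computes the next state, the result and the halting value, and the recurrent edges start at the
gates for the next state. -/
theorem exists_recCircuit {B : Set (ℝ → ℝ)} {L : ℕ} {X Y : Type} [Fintype X] [Fintype Y]
    (e : X ≃ Fin L) {next : (X ⊕ Y → ℝ) → X ⊕ Y → ℝ} {res : (X ⊕ Y → ℝ) → X → ℝ}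
    {hval : (X ⊕ Y → ℝ) → ℝ} {s d : ℕ}
    (hnext : ∀ c, NetComputable B (fun z => next z c) s d)
    (hres : ∀ c, NetComputable B (fun z => res z c) s d) (hhval : NetComputable B hval s d)
    (init : Y → ℝ) {D : ∀ k, Circuit k 1}
    (hD : ComputesHalt (D (1 + 1)) fun _ (v : Fin 1 → ℝ) => decide (0 < v 0)) :
    ∃ R : RecCircuit L L, R.circ.GatesIn B ∧
      R.circ.size ≤ 2 * L + Fintype.card Y + 2 * ((2 * L + Fintype.card Y + 1) * s) ∧
      R.circ.depth ≤ 2 * d + 3 ∧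
      ComputesHalt (D (R.numHalt + 1)) R.halt ∧
      ∀ x : X → ℝ,
        (∀ t, R.HaltsAt (x ∘ e.symm) t ↔ 0 < hval (next^[t] (Sum.elim x init))) ∧
        ∀ t, R.circ.eval (R.memory (x ∘ e.symm) t).1 (R.memory (x ∘ e.symm) t).2 =
          res (next^[t] (Sum.elim x init)) ∘ e.symm := by
  let eY := Fintype.equivFin Y
  let φ : X ⊕ Y → Fin L ⊕ Fin (Fintype.card Y) := Sum.map e eY
  let f : (X ⊕ Y) ⊕ (X ⊕ Unit) → (X ⊕ Y → ℝ) → ℝ :=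
    Sum.elim (fun c z => next z c) (Sum.elim (fun c z => res z c) fun _ => hval)
  have hf : ∀ o, NetComputable B (fun y : Fin L ⊕ Fin (Fintype.card Y) → ℝ =>
      f o fun c => y (φ c)) s d := by
    rintro (c | c | c)
    · exact (hnext c).rename φ
    · exact (hres c).rename φ
    · exact hhval.rename φ
  obtain ⟨C, gate, h1, h2, h3, h4, h5, h6⟩ :=
    exists_circuit (m := L) hf fun j => .inr (.inl (e.symm j))
  let R : RecCircuit L L :=
    { numAux := Fintype.card Y
      circ := C
      init := init ∘ eY.symm
      recIn := fun j => gate (.inl (.inl (e.symm j)))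
      recAux := fun j => gate (.inl (.inr (eY.symm j)))
      recIn_ne := fun _ _ => h1 _ _
      recAux_ne := fun _ _ => h1 _ _
      numHalt := 1
      haltGate := ⟨fun _ => gate (.inr (.inr ())), fun _ _ _ => Subsingleton.elim _ _⟩
      halt := fun _ v => decide (0 < v 0) }
  -- The memory contents, read through the numbering `φ`, form the orbit of `next`.
  have hmem : ∀ (x : X → ℝ) (t : ℕ),
      (fun c => Sum.elim (R.memory (x ∘ e.symm) t).1 (R.memory (x ∘ e.symm) t).2 (φ c)) =
        next^[t] (Sum.elim x init) := by
    intro x t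
    induction t with
    | zero => funext c; rcases c with c | c <;> simp [RecCircuit.memory, φ, R]
    | succ t ih =>
      rw [Function.iterate_succ_apply', ← ih]
      funext c
      rcases c with c | c
      · have := h2 (R.memory (x ∘ e.symm) t).1 (R.memory (x ∘ e.symm) t).2 (.inl (.inl c))
        simpa [RecCircuit.memory, φ, R, f] using this
      · have := h2 (R.memory (x ∘ e.symm) t).1 (R.memory (x ∘ e.symm) t).2 (.inl (.inr c))
        simpa [RecCircuit.memory, φ, R, f] using this
  refine ⟨R, h4, ?_, h6, hD, fun x => ⟨fun t => ?_, fun t => ?_⟩⟩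
  · refine h5.trans_eq ?_
    have : Fintype.card X = L := by simpa using Fintype.card_congr e
    simp only [Fintype.card_sum, Fintype.card_unit, this]
    ring
  · have := h2 (R.memory (x ∘ e.symm) t).1 (R.memory (x ∘ e.symm) t).2 (.inr (.inr ()))
    rw [hmem] at this
    rw [← show f (.inr (.inr ())) (next^[t] (Sum.elim x init)) =
      hval (next^[t] (Sum.elim x init)) from rfl, ← this]
    exact decide_eq_true_iff
  · funext j
    refine (h3 _ _ j).trans ?_
    rw [hmem]
    rfl

/-! ### Encodings -/

/-- The numbering of the entries of the encodings of graphs of order `n`. -/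
def inCoordEquiv (n : ℕ) : NetworkData.InCoord n ≃ Fin (n * n + n) :=
  (Equiv.sumCongr finProdFinEquiv (Equiv.refl _)).trans finSumFinEquiv

open Classical in
theorem LabelledGraph.encode_eq (G : LabelledGraph) :
    G.encode = List.ofFn
      ((Sum.elim (fun p : Fin G.order × Fin G.order => if G.graph.Adj p.1 p.2 then (1 : ℝ) else 0)
        G.feature) ∘ (inCoordEquiv G.order).symm) := by
  -- It suffices to compare positions as natural numbers, which avoids computing the inverse of the
  -- numbering.
  have key : ∀ (g : NetworkData.InCoord G.order → ℝ) (c : NetworkData.InCoord G.order)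
      (j : Fin (G.order * G.order + G.order)), (inCoordEquiv G.order c : ℕ) = j →
      g c = (g ∘ (inCoordEquiv G.order).symm) j := by
    intro g c j h
    obtain rfl := Fin.ext h
    simp
  rw [List.ofFn_add, List.ofFn_mul, encode]
  congr 1
  · congr 2
    funext v
    congr 1
    funext w
    refine key (Sum.elim (fun p : Fin G.order × Fin G.order =>
      if G.graph.Adj p.1 p.2 then (1 : ℝ) else 0) G.feature) (.inl (v, w)) _ ?_
    simp [inCoordEquiv, mul_comm, add_comm]
  · congr 1
    funext v
    refine key (Sum.elim _ G.feature) (.inr v) _ ?_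
    simp [inCoordEquiv]

/-! ### The recurrent circuits for a network -/

namespace NetworkData

variable {d : ℕ} {S : NetworkData d} {F : CircuitClass} {A : Set (ℝ → ℝ)} {N : RecGNN}

variable (S) in
/-- The initial values of the auxiliary memory gates of the simulation. -/
def auxInit (n : ℕ) : S.AuxCoord n → ℝ :=
  Sum.elim (fun _ => 1) (Sum.elim (fun c => if c = ((0 + 1 : ℕ) : ZMod d) then 1 else 0) fun _ => 0)

open Classical in
-- The flag for a first iteration starts at 1, so the zeros stored for the instances are never read.
theorem simulates_auxInit (G : LabelledGraph) :
    Simulates (S := S) G 0 0 G.feature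
      (Sum.elim (Sum.elim (fun p => if G.graph.Adj p.1 p.2 then 1 else 0) G.feature)
        (S.auxInit G.order)) := by
  refine ⟨fun _ _ => rfl, fun _ => rfl, by simp [cnt, auxInit], fun _ => ?_, fun w => ?_⟩
  · simp [phase, auxInit]
  · refine Eq.trans (funext fun x => ?_) (loaded_eq (S := S) (H := G.feature)
      (s := Sum.elim (Sum.elim (fun p => if G.graph.Adj p.1 p.2 then 1 else 0) G.feature)
        (S.auxInit G.order)) (fun _ _ => rfl) (fun _ => rfl) 0 w)
    simp [cur, fresh, auxInit]

variable [NeZero d]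

theorem exists_simulation_recCircuit (h : S.IsOfClass F A) (hS : S.Represents N)
    {D : ∀ k, Circuit k 1}
    (hD : ComputesHalt (D (1 + 1)) fun _ (v : Fin 1 → ℝ) => decide (0 < v 0)) :
    ∃ a k b, ∀ n, ∃ R : RecCircuit (n * n + n) (n * n + n),
      R.circ.GatesIn (F.withSign.adjoin A).gates ∧ R.circ.size ≤ a * (n + 1) ^ k ∧
      R.circ.depth ≤ b * binLen n ^ F.exponent ∧ ComputesHalt (D (R.numHalt + 1)) R.halt ∧
      ∀ G : LabelledGraph, G.order = n → ∀ x, List.ofFn x = G.encode →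
        (R.eval x).map List.ofFn = (N.eval G).map LabelledGraph.encode := by
  classical
  obtain ⟨a₁, k₁, b₁, h₁⟩ := h.next
  obtain ⟨a₂, k₂, b₂, h₂⟩ := h.result
  obtain ⟨a₃, k₃, b₃, h₃⟩ := h.haltVal (ord := fun n : ℕ => n)
  have hsize : PolyBdd (fun n : ℕ => n) fun n =>
      2 * (n * n + n) + Fintype.card (S.AuxCoord n) +
        2 * ((2 * (n * n + n) + Fintype.card (S.AuxCoord n) + 1) *
          ((a₁ + a₂ + a₃) * (n + 1) ^ (k₁ + k₂ + k₃))) := by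
    have h1 := ((PolyBdd.const 2).mul ((PolyBdd.self.mul PolyBdd.self).add PolyBdd.self)).add
      (h.polyBdd_auxCoord (ord := fun n : ℕ => n))
    exact h1.add ((PolyBdd.const 2).mul
      ((h1.add (PolyBdd.const 1)).mul ⟨a₁ + a₂ + a₃, k₁ + k₂ + k₃, fun n => le_rfl⟩))
  obtain ⟨a, k, hsize⟩ := hsize
  refine ⟨a, k, 2 * (b₁ + b₂ + b₃) + 3, fun n => ?_⟩
  obtain ⟨R, r1, r2, r3, r4, r5⟩ := exists_recCircuit (inCoordEquiv n)
    (B := (F.withSign.adjoin A).gates) (Y := S.AuxCoord n)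
    (next := S.next) (res := S.result) (hval := S.haltVal)
    (s := (a₁ + a₂ + a₃) * (n + 1) ^ (k₁ + k₂ + k₃))
    (d := (b₁ + b₂ + b₃) * binLen n ^ F.exponent)
    (fun c => (h₁ ⟨n, c⟩).mono (poly_mono (by omega) (by omega))
      (Nat.mul_le_mul_right _ (by omega)))
    (fun c => (h₂ ⟨n, c⟩).mono (poly_mono (by omega) (by omega))
      (Nat.mul_le_mul_right _ (by omega)))
    ((h₃ n).mono (poly_mono (by omega) (by omega)) (Nat.mul_le_mul_right _ (by omega)))
    (S.auxInit n) hD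
  refine ⟨R, r1, r2.trans (hsize n), r3.trans ?_, r4, ?_⟩
  · have h7 : 1 ≤ binLen n ^ F.exponent := Nat.pow_pos (one_le_binLen n)
    rw [add_mul (2 * _), mul_assoc 2]
    omega
  · rintro G rfl x hx
    rw [G.encode_eq] at hx
    obtain rfl := List.ofFn_injective hx
    obtain ⟨q1, q2⟩ := r5 (Sum.elim (fun p => if G.graph.Adj p.1 p.2 then (1 : ℝ) else 0) G.feature)
    have hsim := simulates_auxInit (S := S) G
    by_cases hex : ∃ t, R.HaltsAt ((Sum.elim
        (fun p : Fin G.order × Fin G.order => if G.graph.Adj p.1 p.2 then (1 : ℝ) else 0)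
        G.feature) ∘ (inCoordEquiv G.order).symm) t
    · have hlt := fun t => Nat.find_min hex (m := t)
      have ht := Nat.find_spec hex
      rw [R.eval_eq_some ht fun t => hlt t, q2]
      obtain ⟨H', h1, h2⟩ := result_of_first_halting hS hsim ((q1 _).1 ht)
        fun t ht' hc => hlt t ht' ((q1 t).2 hc)
      rw [h1, h2, Part.map_some, Part.map_some, LabelledGraph.encode_eq]
    -- A halting layer of the network would produce a halting iteration of the circuit, so both
    -- sides are undefined.
    · have hN : ¬ ∃ i, N.HaltsAt G i := fun ⟨i, hi⟩ =>
        hex ((exists_halting hS hsim hi).imp fun t ht => (q1 t).2 ht)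
      rw [R.eval_eq_none hex, RecGNN.eval, Part.assert_neg hN, Part.map_none, Part.map_none]

theorem exists_mem_recClass (h : S.IsOfClass F A) (hS : S.Represents N) :
    ∃ f ∈ recClass F.withSign (F.withSign.adjoin A),
      ∀ G : LabelledGraph, f G.encode = (N.eval G).map LabelledGraph.encode := by
  obtain ⟨D, hDF, hD⟩ := exists_haltCircuits F
  obtain ⟨a, k, b, hR⟩ := exists_simulation_recCircuit h hS hD
  have key : ∀ L : ℕ, ∃ R : RecCircuit L L,
      R.circ.GatesIn (F.withSign.adjoin A).gates ∧ R.circ.size ≤ (a + 6) * (L + 1) ^ (k + 1) ∧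
      R.circ.depth ≤ (b + 3) * binLen L ^ F.exponent ∧ ComputesHalt (D (R.numHalt + 1)) R.halt ∧
      ∀ G : LabelledGraph, ∀ x : Fin L → ℝ, List.ofFn x = G.encode →
        (R.eval x).map List.ofFn = (N.eval G).map LabelledGraph.encode := by
    intro L
    have hlen : ∀ (G : LabelledGraph) (x : Fin L → ℝ), List.ofFn x = G.encode →
        L = G.order * G.order + G.order := by
      intro G x hx
      have := congrArg List.length hx
      rwa [G.encode_eq, List.length_ofFn, List.length_ofFn] at this
    by_cases hL : ∃ n, L = n * n + n
    · obtain ⟨n, rfl⟩ := hL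
      obtain ⟨R, r1, r2, r3, r4, r5⟩ := hR n
      have hn : n ≤ n * n + n := Nat.le_add_left _ _
      refine ⟨R, r1, r2.trans ?_, r3.trans ?_, r4, fun G x hx => r5 G ?_ x hx⟩
      · refine (Nat.mul_le_mul_left a (Nat.pow_le_pow_left (Nat.succ_le_succ hn) k)).trans
          (poly_mono (by omega) (by omega))
      · exact Nat.mul_le_mul (by omega) (Nat.pow_le_pow_left (binLen_mono hn) _)
      · have h1 := hlen G x hx
        -- The map `n ↦ n * n + n` is strictly increasing, so the input length determines the order.
        rcases lt_trichotomy G.order n with h2 | h2 | h2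
        · nlinarith
        · exact h2
        · nlinarith
    -- No graph has an encoding of this length, so a small circuit with halting value constantly 0
    -- serves to complete the family.
    · obtain ⟨R, r1, r2, r3, r4, -⟩ := exists_recCircuit (Equiv.refl (Fin L))
        (B := (F.withSign.adjoin A).gates) (Y := Fin 0)
        (next := id) (res := fun z c => z (.inl c)) (hval := fun _ => 0) (s := 1) (d := 0)
        (fun c => NetComputable.var c) (fun c => NetComputable.var _) (NetComputable.const 0)
        Fin.elim0 hD
      refine ⟨R, r1, r2.trans ?_, r3.trans ?_, r4,
        fun G x hx => absurd ⟨G.order, hlen G x hx⟩ hL⟩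
      -- The filler circuit has size at most `6 * L + 2` and depth at most 3, whence the constants
      -- `a + 6` and `b + 3`.
      · refine le_trans ?_ (poly_mono (a := 6) (k := 1) (by omega) (by omega))
        simp only [Fintype.card_fin, pow_one]
        omega
      · have h7 : 1 ≤ binLen L ^ F.exponent := Nat.pow_pos (one_le_binLen L)
        nlinarith
  choose R r1 r2 r3 r4 r5 using key
  refine ⟨_, ⟨⟨fun L => L, R⟩, ?_, ⟨D, hDF, r4⟩, rfl⟩, fun G => ?_⟩
  · exact CircuitClass.isFamily_of_bounds r1 ⟨a + 6, k + 1, r2⟩ ⟨b + 3, r3⟩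
  · exact r5 _ G _ (List.ofFn_get _)

end NetworkData

/-! ### Extraction of circuits from a network -/

/-- The data of a network of the given type. -/
theorem RecGNN.IsOfType.exists_networkData {F : CircuitClass} {A : Set (ℝ → ℝ)} {N : RecGNN}
    (hN : N.IsOfType F.withSign F.withSign F A) :
    ∃ (d : ℕ) (_ : NeZero d) (S : NetworkData d), S.IsOfClass F A ∧ S.Represents N := by
  obtain ⟨⟨d, hd, hper⟩, hlayer, -, O, hO, hOv⟩ := hN
  have : NeZero d := ⟨hd.ne'⟩
  have hc : ∀ c : ZMod d, ∃ R : RecFamily,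
      F.IsFamily (fun n => (R.circuit n).circ) ∧
      (∃ D : ∀ k, Circuit k 1, F.withSign.IsFamily D ∧
        ∀ n, ComputesHalt (D ((R.circuit n).numHalt + 1)) (R.circuit n).halt) ∧
      R.eval = fun x => ((N.layer c.val).1 x).map fun y => [y] :=
    fun c => (hlayer c.val).1.2
  choose Q hQ hD hQe using hc
  choose D hD using hD
  -- By periodicity one choice of circuits per residue serves all layers, which keeps the constants
  -- in the bounds uniform.
  have hmod : ∀ i : ℕ, N.layer i = N.layer (i : ZMod d).val := fun i => by
    rw [ZMod.val_natCast, hper.map_mod_nat]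
  refine ⟨d, this, ⟨Q, D, fun c => (N.layer c.val).2, O⟩,
    ⟨hQ, fun c => (hD c).1, fun c => (hlayer c.val).2, hO⟩, ⟨fun i => ?_, fun i => ?_, ?_, hOv⟩⟩
  · rw [hmod i, hQe]
  · rw [hmod i]
  · exact fun c n => (hD c).2 n

end

end RecCirc


theorem mainTheorem3 (F : RecCirc.CircuitClass) (A : Set (ℝ → ℝ)) (N : RecCirc.RecGNN)
    (hN : N.IsOfType F.withSign F.withSign F A) :
    ∃ f ∈ RecCirc.recClass F.withSign (F.withSign.adjoin A),
      ∀ G : RecCirc.LabelledGraph, f G.encode = (N.eval G).map RecCirc.LabelledGraph.encode := by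
  obtain ⟨d, _, S, hS, hSN⟩ := hN.exists_networkData
  exact RecCirc.NetworkData.exists_mem_recClass hS hSN
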